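/- Let $d\ge 1$, let $M$ be the number of players, and let the target $X^*\in\mathbb R^d$ and the vector of unknown crossover probabilities $\epsilon^*=(\epsilon_1,\dots,\epsilon_M)\in(0,1/2)^M$ have a joint prior density $p_0(x,\epsilon)$ with finite differential entropy (for instance, $\epsilon^*$ uniform on $(0,1/2)^M$ and independent of $X^*$). Logarithms are to base 2; $h_b(e)=-e\log e-(1-e)\log(1-e)$, and $C(e)=1-h_b(e)$ is the capacity of the binary symmetric channel with crossover probability $e$. In each cycle $n=0,1,\dots$ every player $m=1,\dots,M$ is asked one question "does $X^*$ lie in $A_n^{(m)}$?" with $A_n^{(m)}\subseteq\mathbb R^d$ Borel, and gives a binary response $Y_{n+1}^{(m)}\in\{0,1\}$. * *Joint scheme.* A joint policy chooses all $A_n^{(1)},\dots,A_n^{(M)}$ as functions of the responses of the cycles before $n$; $\mathcal F_n$ is the $\sigma$-algebra generated by these responses. Given $X^*$, $\epsilon^*$ and $\mathcal F_n$, the responses $Y_{n+1}^{(1)},\dots,Y_{n+1}^{(M)}$ are conditionally independent, and $Y_{n+1}^{(m)}$ equals $I(X^*\in A_n^{(m)})$ with probability $1-\epsilon_m$ and differs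 from it with probability $\epsilon_m$. * *Sequential scheme.* The players are asked one after another. A sequential policy chooses $A_{n,t}$ (the question to player $t+1$, $0\le t<M$) as a function of the responses of the cycles before $n$ and of those of players $1,\dots,t$ in cycle $n$; $\mathcal G_{n,t}$ is the $\sigma$-algebra generated by these responses, and $\mathcal G_n=\mathcal G_{n,0}$. Given $X^*$, $\epsilon^*$ and $\mathcal G_{n,t}$, the response of player $t+1$ equals $I(X^*\in A_{n,t})$ with probability $1-\epsilon_{t+1}$ and differs from it with probability $\epsilon_{t+1}$. Let $\mathbb E^\zeta$ be the expectation under the probability measure $\mathbb P^\zeta$ induced by a policy $\zeta$, let $p_n$ be the joint posterior density of $(X^*,\epsilon^*)$ given the responses of the cycles before $n$, and let $H(p_n)=-\int p_n\log p_n$. For a policy $\zeta$ let $$G_n^*=\operatorname*{ess\,sup}_{\zeta'}\ \mathbb E^{\zeta'}[H(p_n)-H(p_{n+1})\mid\mathcal F_n]\quad\text{(joint)},\qquad G_{seq,n}^*=\operatorname*{ess\,sup}_{\zeta'}\ \mathbb E^{\zeta'}[H(p_n)-H(p_{n+1})\mid\mathcal G_n]\quad\text{(sequential)}$$ be the maximal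 expected entropy losses in cycle $n$, where $\zeta'$ runs over the joint, respectively sequential, policies that ask the same queries as $\zeta$ in all cycles before $n$. Then for every $n$ and every policy $\zeta$ of the respective type, $\mathbb P^\zeta$-almost surely, $$G_{seq,n}^*=\mathbb E^\zeta\Big[\sum_{m=1}^M C(\epsilon_m)\,\Big|\,\mathcal G_n\Big],\qquad G_n^*=\mathbb E^\zeta\Big[\sum_{m=1}^M C(\epsilon_m)\,\Big|\,\mathcal F_n\Big].$$ In particular the two designs are equivalent on average: whatever the policies used in the past, $\mathbb E[G_{seq,n}^*]=\mathbb E[G_n^*]=\int\sum_{m=1}^M C(\epsilon_m)\,p_0(x,\epsilon)\,dx\,d\epsilon$. -/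

import Mathlib

open MeasureTheory ProbabilityTheory

noncomputable section

namespace TwentyQuestions

/-- The state space of the target. -/
abbrev Target (d : ℕ) : Type := EuclideanSpace ℝ (Fin d)

/-- Values of the pair (target location, vector of crossover probabilities). -/
abbrev Param (d M : ℕ) : Type := Target d × (Fin M → ℝ)

/-- Infinite tables of binary responses: `y n m` is the answer of player `m` in cycle `n`. -/
abbrev Responses (M : ℕ) : Type := ℕ → Fin M → Bool

/-- Binary entropy in bits. -/
def binEntropyBits (e : ℝ) : ℝ :=
  -e * Real.logb 2 e - (1 - e) * Real.logb 2 (1 - e)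

/-- Capacity (in bits) of the binary symmetric channel with crossover probability `e`. -/
def capacity (e : ℝ) : ℝ := 1 - binEntropyBits e

/-- Differential entropy (in bits) of a measure with a Lebesgue density. -/
def diffEntropy {d M : ℕ} (ν : Measure (Param d M)) : ℝ :=
  -∫ θ, (ν.rnDeriv volume θ).toReal * Real.logb 2 (ν.rnDeriv volume θ).toReal

/-- `p₀` is a joint probability density of target and crossover probabilities, carried by
`ℝ^d × (0, 1/2)^M`, with finite differential entropy. -/
structure IsPrior {d M : ℕ} (p₀ : Param d M → ℝ) : Prop where
  measurable : Measurable p₀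
  nonneg : ∀ θ, 0 ≤ p₀ θ
  integral_eq_one : ∫ θ, p₀ θ = 1
  support : ∀ θ, p₀ θ ≠ 0 → ∀ m, θ.2 m ∈ Set.Ioo (0 : ℝ) (1 / 2)
  finite_entropy : Integrable (fun θ => p₀ θ * Real.logb 2 (p₀ θ))

/-- `(k, j)` (cycle, player) precedes sub-instant `t` of cycle `n`. -/
def Before {M : ℕ} (n t k : ℕ) (j : Fin M) : Prop := k < n ∨ (k = n ∧ (j : ℕ) < t)

/-- A joint query policy: all `M` (measurable) query regions of cycle `n` are functions of the
responses obtained in the cycles before `n`. -/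
structure JointPolicy (d M : ℕ) where
  query : ℕ → Fin M → Responses M → Set (Target d)
  measurableSet_query : ∀ n m y, MeasurableSet (query n m y)
  adapted : ∀ n m y y', (∀ k j, Before n 0 k j → y k j = y' k j) → query n m y = query n m y'

/-- A sequential query policy: the (measurable) query region for player `m` in cycle `n` is a
function of the responses of the cycles before `n` and of the players before `m` in cycle `n`. -/
structure SeqPolicy (d M : ℕ) where
  query : ℕ → Fin M → Responses M → Set (Target d)
  measurableSet_query : ∀ n m y, MeasurableSet (query n m y)
  adapted : ∀ n (m : Fin M) y y', (∀ k j, Before n m k j → y k j = y' k j) →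
    query n m y = query n m y'

/-- The two joint policies ask the same queries in all cycles before `n`. -/
def JointPolicy.SamePast {d M : ℕ} (n : ℕ) (π π' : JointPolicy d M) : Prop :=
  ∀ k < n, π'.query k = π.query k

/-- The two sequential policies ask the same queries in all cycles before `n`. -/
def SeqPolicy.SamePast {d M : ℕ} (n : ℕ) (π π' : SeqPolicy d M) : Prop :=
  ∀ k < n, π'.query k = π.query k

open Classical in
/-- Binary symmetric channel: probability of answer `b` to the query "is `x ∈ A`?" for a player
with crossover probability `e`. -/
def bsc {d : ℕ} (e : ℝ) (A : Set (Target d)) (x : Target d) (b : Bool) : ℝ :=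
  if (x ∈ A ↔ b = true) then 1 - e else e

section Schemes

variable {d M : ℕ} {Ω : Type*} [MeasurableSpace Ω]

/-- The information available at sub-instant `t` of cycle `n`. The queries are functions of
past responses, so it is generated by the responses. -/
def info (Y : ℕ → Fin M → Ω → Bool) (n t : ℕ) : MeasurableSpace Ω :=
  ⨆ (k : ℕ) (j : Fin M) (_ : Before n t k j), MeasurableSpace.comap (Y k j) ⊤

/-- The information at sub-instant `t` of cycle `n` together with target and crossover
probabilities. -/
def fullInfo (X : Ω → Target d) (ε : Ω → Fin M → ℝ) (Y : ℕ → Fin M → Ω → Bool) (n t : ℕ) :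
    MeasurableSpace Ω :=
  MeasurableSpace.comap (fun ω => (X ω, ε ω)) inferInstance ⊔ info Y n t

/-- The table of responses realized at `ω`. -/
def resp (Y : ℕ → Fin M → Ω → Bool) (ω : Ω) : Responses M := fun k j => Y k j ω

/-- Under `μ`, the pair `(X, ε)` has prior density `p₀`, and the responses `Y` come from the joint
scheme with policy `π`: given target, crossover probabilities and the past cycles, the `M`
responses of a cycle are independent outputs of binary symmetric channels. -/
structure IsJointScheme (p₀ : Param d M → ℝ) (X : Ω → Target d) (ε : Ω → Fin M → ℝ)
    (Y : ℕ → Fin M → Ω → Bool) (π : JointPolicy d M) (μ : Measure Ω) : Prop where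
  isProbabilityMeasure : IsProbabilityMeasure μ
  measurable_target : Measurable X
  measurable_crossover : Measurable ε
  measurable_response : ∀ n m, Measurable (Y n m)
  prior : μ.map (fun ω => (X ω, ε ω)) = volume.withDensity (fun θ => ENNReal.ofReal (p₀ θ))
  condIndep : ∀ n (y : Fin M → Bool),
    μ⟦{ω | ∀ m, Y n m ω = y m} | fullInfo X ε Y n 0⟧ =ᵐ[μ]
      fun ω => ∏ m, (μ⟦{ω' | Y n m ω' = y m} | fullInfo X ε Y n 0⟧) ω
  channel : ∀ n m b,
    μ⟦{ω | Y n m ω = b} | fullInfo X ε Y n 0⟧ =ᵐ[μ]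
      fun ω => bsc (ε ω m) (π.query n m (resp Y ω)) (X ω) b

/-- Under `μ`, the pair `(X, ε)` has prior density `p₀`, and the responses `Y` come from the
sequential scheme with policy `π`: given target, crossover probabilities and all earlier
responses, the response of the queried player is the output of a binary symmetric channel. -/
structure IsSeqScheme (p₀ : Param d M → ℝ) (X : Ω → Target d) (ε : Ω → Fin M → ℝ)
    (Y : ℕ → Fin M → Ω → Bool) (π : SeqPolicy d M) (μ : Measure Ω) : Prop where
  isProbabilityMeasure : IsProbabilityMeasure μ
  measurable_target : Measurable X
  measurable_crossover : Measurable ε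
  measurable_response : ∀ n m, Measurable (Y n m)
  prior : μ.map (fun ω => (X ω, ε ω)) = volume.withDensity (fun θ => ENNReal.ofReal (p₀ θ))
  channel : ∀ n (m : Fin M) b,
    μ⟦{ω | Y n m ω = b} | fullInfo X ε Y n m⟧ =ᵐ[μ]
      fun ω => bsc (ε ω m) (π.query n m (resp Y ω)) (X ω) b

/-- Posterior distribution at the start of cycle `n`: the conditional law of `(X, ε)` given the
event that the responses of the cycles before `n` are those realized at `ω`. -/
def posterior (X : Ω → Target d) (ε : Ω → Fin M → ℝ) (Y : ℕ → Fin M → Ω → Bool)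
    (μ : Measure Ω) (n : ℕ) (ω : Ω) : Measure (Param d M) :=
  (ProbabilityTheory.cond μ {ω' | ∀ k < n, ∀ m, Y k m ω' = Y k m ω}).map
    (fun ω' => (X ω', ε ω'))

/-- Expected entropy loss in cycle `n`, conditional on the information at its start. -/
def cycleLoss (X : Ω → Target d) (ε : Ω → Fin M → ℝ) (Y : ℕ → Fin M → Ω → Bool)
    (μ : Measure Ω) (n : ℕ) : Ω → ℝ :=
  μ[fun ω => diffEntropy (posterior X ε Y μ n ω) - diffEntropy (posterior X ε Y μ (n + 1) ω)
    | info Y n 0]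

/-- `g` is an essential supremum, under `μ`, of the family `S` of random variables. -/
def IsEssSup (μ : Measure Ω) (S : Set (Ω → ℝ)) (g : Ω → ℝ) : Prop :=
  (∀ f ∈ S, f ≤ᵐ[μ] g) ∧ ∀ g' : Ω → ℝ, (∀ f ∈ S, f ≤ᵐ[μ] g') → g ≤ᵐ[μ] g'

/-- `g` is the maximal expected entropy loss of the joint scheme in cycle `n`, after the cycles
before `n` were played with `π`; `P π'` is the probability measure induced by the policy `π'`. -/
def IsMaxJointLoss (X : Ω → Target d) (ε : Ω → Fin M → ℝ) (Y : ℕ → Fin M → Ω → Bool)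
    (P : JointPolicy d M → Measure Ω) (π : JointPolicy d M) (n : ℕ) (g : Ω → ℝ) : Prop :=
  IsEssSup (P π) {f | ∃ π' : JointPolicy d M, JointPolicy.SamePast n π π' ∧
    f = cycleLoss X ε Y (P π') n} g

/-- The same for the sequential scheme. -/
def IsMaxSeqLoss (X : Ω → Target d) (ε : Ω → Fin M → ℝ) (Y : ℕ → Fin M → Ω → Bool)
    (P : SeqPolicy d M → Measure Ω) (π : SeqPolicy d M) (n : ℕ) (g : Ω → ℝ) : Prop :=
  IsEssSup (P π) {f | ∃ π' : SeqPolicy d M, SeqPolicy.SamePast n π π' ∧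
    f = cycleLoss X ε Y (P π') n} g

end Schemes

end TwentyQuestions

end

/-! Fix a response history `h` before cycle `n`. On its atom, `(X, ε)` has unnormalized density `p₀
* lik q n h`, with mass `Z`; write `Z_y` for the mass after the answer vector `y` of cycle `n`. The
entropy loss is a mutual information, so `Z` times its expectation is `(Z log Z - ∑_y Z_y log Z_y) -
∫ p₀ lik ∑ h_b(ε_m)`: entropy of the answers minus entropy of the noise (`cycleLoss_mul`). The noise
term does not depend on the queries, because for a fixed target the answers correspond bijectively
to the vector of correct/incorrect marks, even for adaptive queries (`bijective_correctness`). By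
Jensen the answer term is at most `M Z`, which gives the upper bound `∑ C(ε_m)` in conditional mean
(`cycleLoss_le`).

The bound is approached rather than attained. Player `m` is asked for the parity of the dyadic
interval of length `2^-(k+m)` that contains one coordinate. Each channel is `1/2` plus a signed
term; after expanding the product, every nonconstant term changes sign under a translation that
shrinks to zero as `k → ∞`, so its integral vanishes in the limit by `L¹`-continuity of translations
(`tendsto_integral_mul_prod_bsc_evenDyadic`). All `Z_y` tend to `2^-M Z`, and an a.e. limit of
members of the family that bounds the family is its essential supremum.

These queries ignore the current answers, so they serve both schemes. A joint policy is a special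
sequential one, and both schemes enter only through `HasLikelihood`. The averaged statement is the
tower property. -/

noncomputable section

namespace TwentyQuestions

open Filter Topology

/-! ### Oscillating functions integrate to zero in the limit -/

/-- Continuity of translations in `L¹`, read off from the continuous action of `Eᵈᵃᵃ` on `Lp`. -/
theorem tendsto_integral_abs_sub_translate {E : Type*} [NormedAddCommGroup E] [NormedSpace ℝ E]
    [FiniteDimensional ℝ E] [MeasurableSpace E] [BorelSpace E] (μ : Measure E)
    [μ.IsAddHaarMeasure] {g : E → ℝ} (hg : Integrable g μ) {v : ℕ → E}
    (hv : Tendsto v atTop (𝓝 0)) :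
    Tendsto (fun k => ∫ θ, |g (v k + θ) - g θ| ∂μ) atTop (𝓝 0) := by
  have hf : MemLp g 1 μ := memLp_one_iff_integrable.2 hg
  have : Fact ((1 : ENNReal) ≠ ⊤) := ⟨ENNReal.one_ne_top⟩
  have hcont : Continuous fun c : E => (DomAddAct.mk c) +ᵥ hf.toLp g :=
    (continuous_id.vadd continuous_const).comp DomAddAct.mkHomeomorph.continuous
  have h := (hcont.tendsto 0).comp hv
  rw [tendsto_iff_dist_tendsto_zero] at h
  refine h.congr fun k => ?_
  have e0 : (DomAddAct.mk (0 : E)) +ᵥ hf.toLp g = hf.toLp g := by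
    change (0 : Eᵈᵃᵃ) +ᵥ _ = _
    exact zero_vadd _ _
  simp only [Function.comp_apply, e0]
  rw [DomAddAct.mk_vadd_toLp, dist_eq_norm, ← MemLp.toLp_sub, L1.norm_eq_integral_norm]
  refine integral_congr_ae ?_
  filter_upwards [MemLp.coeFn_toLp ((hf.comp_measurePreserving
    (measurePreserving_vadd (v k) μ)).sub hf)] with θ hθ
  exact congrArg _ hθ

/-- A Riemann–Lebesgue argument without Fourier analysis: translating by `v k` flips the sign of `R
k`, so twice the integral equals `-∫ (g (v k + ·) - g) * R k`, which the `L¹` modulus of continuity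
of `g` controls. -/
theorem tendsto_integral_mul_of_antiperiodic {E : Type*} [NormedAddCommGroup E] [NormedSpace ℝ E]
    [FiniteDimensional ℝ E] [MeasurableSpace E] [BorelSpace E] (μ : Measure E)
    [μ.IsAddHaarMeasure] {g : E → ℝ} (hg : Integrable g μ) {v : ℕ → E}
    (hv : Tendsto v atTop (𝓝 0)) {R : ℕ → E → ℝ} (hR : ∀ k, Measurable (R k))
    (hR1 : ∀ k θ, |R k θ| ≤ 1) (hanti : ∀ k θ, R k (v k + θ) = -R k θ) :
    Tendsto (fun k => ∫ θ, g θ * R k θ ∂μ) atTop (𝓝 0) := by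
  refine squeeze_zero_norm (fun k => ?_) (tendsto_integral_abs_sub_translate μ hg hv)
  have hgv : Integrable (fun θ => g (v k + θ)) μ := hg.comp_add_left (v k)
  have hb : ∀ᵐ θ ∂μ, ‖R k θ‖ ≤ 1 := .of_forall (hR1 k)
  have i1 : Integrable (fun θ => g θ * R k θ) μ :=
    hg.mul_bdd (hR k).aestronglyMeasurable hb
  have i2 : Integrable (fun θ => g (v k + θ) * R k θ) μ :=
    hgv.mul_bdd (hR k).aestronglyMeasurable hb
  have e : ∫ θ, g θ * R k θ ∂μ = -∫ θ, g (v k + θ) * R k θ ∂μ := by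
    rw [← integral_add_left_eq_self (fun θ => g θ * R k θ) (v k), ← integral_neg]
    simp only [hanti, mul_neg]
  have e2 : 2 * ∫ θ, g θ * R k θ ∂μ = -∫ θ, (g (v k + θ) - g θ) * R k θ ∂μ := by
    simp only [sub_mul]
    rw [integral_sub i2 i1]
    linarith
  have e3 : |∫ θ, (g (v k + θ) - g θ) * R k θ ∂μ| ≤ ∫ θ, |g (v k + θ) - g θ| ∂μ := by
    refine (abs_integral_le_integral_abs).trans (integral_mono_of_nonneg
      (.of_forall fun _ => abs_nonneg _) (hgv.sub hg).abs (.of_forall fun θ => ?_))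
    simp only [abs_mul]
    exact mul_le_of_le_one_right (abs_nonneg _) (hR1 k θ)
  have e4 : |2 * ∫ θ, g θ * R k θ ∂μ| ≤ ∫ θ, |g (v k + θ) - g θ| ∂μ := by
    rw [e2, abs_neg]; exact e3
  rw [abs_mul, abs_two] at e4
  rw [Real.norm_eq_abs]
  linarith [abs_nonneg (∫ θ, g θ * R k θ ∂μ)]

/-! ### Dyadic queries -/

/-- The points whose `i`-th coordinate lies in an even-numbered dyadic interval of length
`2⁻ʲ`. -/
def evenDyadic {d : ℕ} (i : Fin d) (j : ℕ) : Set (Target d) := {x | Even ⌊2 ^ j * x i⌋}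

open Classical in
/-- The `±1`-valued indicator of a set. -/
def signOf {α : Type*} (A : Set α) (x : α) : ℝ := if x ∈ A then 1 else -1

theorem abs_signOf {α : Type*} (A : Set α) (x : α) : |signOf A x| = 1 := by
  unfold signOf; split_ifs <;> simp

theorem measurable_signOf {α : Type*} [MeasurableSpace α] {A : Set α} (hA : MeasurableSet A) :
    Measurable (signOf A) := by
  classical
  exact Measurable.ite hA measurable_const measurable_const

theorem measurableSet_evenDyadic {d : ℕ} (i : Fin d) (j : ℕ) :
    MeasurableSet (evenDyadic i j) := by
  have h : Measurable fun x : Target d => ⌊(2 : ℝ) ^ j * x i⌋ := by fun_prop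
  exact h (MeasurableSet.of_discrete (s := {z : ℤ | Even z}))

theorem signOf_evenDyadic_shift {d : ℕ} (i : Fin d) (j : ℕ) (x : Target d) :
    signOf (evenDyadic i j) (EuclideanSpace.single i ((2 : ℝ) ^ j)⁻¹ + x) =
      -signOf (evenDyadic i j) x := by
  have h : (2 : ℝ) ^ j * (EuclideanSpace.single i ((2 : ℝ) ^ j)⁻¹ + x) i = 2 ^ j * x i + 1 := by
    simp [mul_add]; ring
  simp only [signOf, evenDyadic, Set.mem_ofPred_eq, h, Int.floor_add_one, Int.even_add_one]
  by_cases he : Even ⌊2 ^ j * x i⌋ <;> simp only [he, not_true, not_false_iff, if_true, if_false,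
    neg_neg]

/-- A coarser step is `2^(l-j)` intervals of the finer grid, an even number since `j < l`. -/
theorem signOf_evenDyadic_shift_of_lt {d : ℕ} (i : Fin d) {j l : ℕ} (hjl : j < l)
    (x : Target d) :
    signOf (evenDyadic i l) (EuclideanSpace.single i ((2 : ℝ) ^ j)⁻¹ + x) =
      signOf (evenDyadic i l) x := by
  obtain ⟨r, rfl⟩ := Nat.exists_eq_add_of_lt hjl
  have h : (2 : ℝ) ^ (j + r + 1) * (EuclideanSpace.single i ((2 : ℝ) ^ j)⁻¹ + x) i =
      2 ^ (j + r + 1) * x i + ((2 * 2 ^ r : ℤ) : ℝ) := by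
    simp [mul_add, pow_add]; field_simp; ring
  simp only [signOf, evenDyadic, Set.mem_ofPred_eq, h, Int.floor_add_intCast]
  by_cases he : Even ⌊2 ^ (j + r + 1) * x i⌋ <;> simp [he, Int.even_add]

/-- Separates the fair-coin part from the part that oscillates with the query, ready for expanding a
product over players. -/
theorem bsc_eq_half_add {d : ℕ} (e : ℝ) (A : Set (Target d)) (x : Target d) (b : Bool) :
    bsc e A x b = (if b then 1 else -1) * (1 / 2 - e) * signOf A x + 1 / 2 := by
  unfold bsc signOf
  cases b <;> by_cases h : x ∈ A <;> simp [h] <;> ring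

theorem measurable_bsc {d M : ℕ} {A : Set (Target d)} (hA : MeasurableSet A) (m : Fin M)
    (b : Bool) : Measurable fun θ : Param d M => bsc (θ.2 m) A θ.1 b := by
  simp only [bsc_eq_half_add]
  have h : Measurable fun θ : Param d M => signOf A θ.1 :=
    (measurable_signOf hA).comp measurable_fst
  fun_prop

/-- Asking player `m` whether `X` lies in `evenDyadic i (k + m)` makes the answers of a cycle
asymptotically uniform. -/
theorem tendsto_integral_mul_prod_bsc_evenDyadic {d M : ℕ} (i : Fin d) {f : Param d M → ℝ}
    (hf : Integrable f) (hsupp : ∀ θ, f θ ≠ 0 → ∀ m, θ.2 m ∈ Set.Ioo (0 : ℝ) (1 / 2))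
    (y : Fin M → Bool) :
    Tendsto (fun k : ℕ => ∫ θ, f θ * ∏ m : Fin M, bsc (θ.2 m) (evenDyadic i (k + m)) θ.1 (y m))
      atTop (𝓝 ((1 / 2) ^ M * ∫ θ, f θ)) := by
  classical
  -- `S` is the set of players whose oscillating term is chosen in the expansion: `w S` collects the
  -- factors free of `k`, `R S k` the signs.
  let w : Finset (Fin M) → Param d M → ℝ := fun S θ =>
    f θ * ((∏ m ∈ S, (if y m then 1 else -1) * (1 / 2 - θ.2 m)) *
      (1 / 2) ^ (Finset.univ \ S).card)
  let R : Finset (Fin M) → ℕ → Param d M → ℝ := fun S k θ =>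
    ∏ m ∈ S, signOf (evenDyadic i (k + m)) θ.1
  have hw : ∀ S, Integrable (w S) := by
    intro S
    have hm : Measurable fun θ : Param d M => (∏ m ∈ S, (if y m then (1 : ℝ) else -1) *
        (1 / 2 - θ.2 m)) * (1 / 2) ^ (Finset.univ \ S).card := by fun_prop
    refine hf.mono (hf.aestronglyMeasurable.mul hm.aestronglyMeasurable) (.of_forall fun θ => ?_)
    by_cases h0 : f θ = 0
    · simp [w, h0]
    · simp only [w, norm_mul]
      refine mul_le_of_le_one_right (norm_nonneg _) (mul_le_one₀ ?_ (norm_nonneg _) ?_)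
      · rw [norm_prod]
        refine Finset.prod_le_one (fun _ _ => norm_nonneg _) fun m _ => ?_
        have := hsupp θ h0 m
        rw [norm_mul]
        refine mul_le_one₀ (by split_ifs <;> simp) (norm_nonneg _) ?_
        rw [Real.norm_eq_abs, abs_le]
        constructor <;> linarith [this.1, this.2]
      · rw [norm_pow]
        exact pow_le_one₀ (norm_nonneg _) (by norm_num)
  have hR : ∀ S k, Measurable (R S k) := fun S k => Finset.measurable_prod _ fun m _ =>
    (measurable_signOf (measurableSet_evenDyadic i _)).comp measurable_fst
  have hR1 : ∀ S k θ, |R S k θ| ≤ 1 := fun S k θ => by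
    simp [R, Finset.abs_prod, abs_signOf]
  have hexp : ∀ k θ, f θ * ∏ m : Fin M, bsc (θ.2 m) (evenDyadic i (k + m)) θ.1 (y m) =
      ∑ S ∈ Finset.univ.powerset, w S θ * R S k θ := by
    intro k θ
    simp only [bsc_eq_half_add]
    rw [Finset.prod_add, Finset.mul_sum]
    refine Finset.sum_congr rfl fun S _ => ?_
    simp only [w, R, Finset.prod_mul_distrib, Finset.prod_const]
    ring
  have hint : ∀ S k, Integrable fun θ => w S θ * R S k θ := fun S k =>
    (hw S).mul_bdd (hR S k).aestronglyMeasurable (.of_forall (hR1 S k))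
  simp only [hexp]
  simp_rw [integral_finsetSum _ fun S _ => hint S _]
  have hlim : ∀ S : Finset (Fin M), Tendsto (fun k => ∫ θ, w S θ * R S k θ) atTop
      (𝓝 (if S = ∅ then (1 / 2) ^ M * ∫ θ, f θ else 0)) := by
    intro S
    split_ifs with hS
    · subst hS
      simp only [w, R, Finset.prod_empty, one_mul, Finset.sdiff_empty, Finset.card_univ,
        Fintype.card_fin, integral_mul_const, mul_comm]
      exact tendsto_const_nhds
    · have : (volume : Measure (Param d M)).IsAddHaarMeasure :=
        Measure.prod.instIsAddHaarMeasure (volume : Measure (Target d)) (volume : Measure (Fin M → ℝ))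
      have hne := Finset.nonempty_iff_ne_empty.2 hS
      -- The coarsest scale present: a step of its length flips its own sign and fixes all finer
      -- ones, so the product is antiperiodic.
      set m₀ := S.min' hne
      refine tendsto_integral_mul_of_antiperiodic volume (hw S)
        (v := fun k => (EuclideanSpace.single i ((2 : ℝ) ^ (k + m₀ : ℕ))⁻¹, 0)) ?_ (hR S) (hR1 S) ?_
      · have h1 : Tendsto (fun k : ℕ => ((2 : ℝ) ^ (k + m₀ : ℕ))⁻¹) atTop (𝓝 0) :=
          tendsto_inv_atTop_zero.comp ((tendsto_pow_atTop_atTop_of_one_lt one_lt_two).comp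
            (tendsto_add_atTop_nat _))
        refine Tendsto.prodMk_nhds ?_ tendsto_const_nhds
        rw [tendsto_zero_iff_norm_tendsto_zero]
        simpa using h1
      · intro k θ
        simp only [R, Prod.fst_add]
        rw [← Finset.mul_prod_erase S _ (S.min'_mem hne),
          ← Finset.mul_prod_erase S _ (S.min'_mem hne), signOf_evenDyadic_shift, neg_mul]
        congr 2
        refine Finset.prod_congr rfl fun m hm => signOf_evenDyadic_shift_of_lt i ?_ _
        have : m₀ < m := Finset.min'_lt_of_mem_erase_min' S hne hm
        have : (m₀ : ℕ) < m := this
        omega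
  have := tendsto_finsetSum Finset.univ.powerset fun S _ => hlim S
  simpa using this

/-! ### Likelihood of a response history -/

theorem bsc_mem_Ioo {d : ℕ} {e : ℝ} (he : e ∈ Set.Ioo (0 : ℝ) (1 / 2)) (A : Set (Target d))
    (x : Target d) (b : Bool) : bsc e A x b ∈ Set.Ioo (0 : ℝ) 1 := by
  unfold bsc
  obtain ⟨h1, h2⟩ := he
  split_ifs <;> constructor <;> linarith

/-- Likelihood of the responses `h n` in cycle `n` after the responses `h` of the earlier
cycles. -/
def cycleLik {d M : ℕ} (q : SeqPolicy d M) (n : ℕ) (h : Responses M) (θ : Param d M) : ℝ :=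
  ∏ m, bsc (θ.2 m) (q.query n m h) θ.1 (h n m)

/-- Likelihood of the responses `h` in the cycles before `n`. -/
def lik {d M : ℕ} (q : SeqPolicy d M) (n : ℕ) (h : Responses M) (θ : Param d M) : ℝ :=
  ∏ k ∈ Finset.range n, cycleLik q k h θ

section

variable {d M : ℕ} (q : SeqPolicy d M)

theorem lik_succ (n : ℕ) (h : Responses M) (θ : Param d M) :
    lik q (n + 1) h θ = lik q n h θ * cycleLik q n h θ :=
  Finset.prod_range_succ _ _

theorem measurable_cycleLik (n : ℕ) (h : Responses M) : Measurable (cycleLik q n h) :=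
  Finset.measurable_prod _ fun m _ => measurable_bsc (q.measurableSet_query n m h) m (h n m)

theorem measurable_lik (n : ℕ) (h : Responses M) : Measurable (lik q n h) :=
  Finset.measurable_prod _ fun k _ => measurable_cycleLik q k h

theorem prod_bsc_mem_Ioc (s : Finset (Fin M)) (A : Fin M → Set (Target d)) (y : Fin M → Bool)
    {θ : Param d M} (hθ : ∀ m, θ.2 m ∈ Set.Ioo (0 : ℝ) (1 / 2)) :
    ∏ m ∈ s, bsc (θ.2 m) (A m) θ.1 (y m) ∈ Set.Ioc (0 : ℝ) 1 :=
  ⟨Finset.prod_pos fun m _ => (bsc_mem_Ioo (hθ m) _ _ _).1,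
    Finset.prod_le_one (fun m _ => (bsc_mem_Ioo (hθ m) _ _ _).1.le)
      fun m _ => (bsc_mem_Ioo (hθ m) _ _ _).2.le⟩

theorem cycleLik_mem_Ioc (n : ℕ) (h : Responses M) {θ : Param d M}
    (hθ : ∀ m, θ.2 m ∈ Set.Ioo (0 : ℝ) (1 / 2)) : cycleLik q n h θ ∈ Set.Ioc (0 : ℝ) 1 :=
  prod_bsc_mem_Ioc _ _ _ hθ

theorem lik_mem_Ioc (n : ℕ) (h : Responses M) {θ : Param d M}
    (hθ : ∀ m, θ.2 m ∈ Set.Ioo (0 : ℝ) (1 / 2)) : lik q n h θ ∈ Set.Ioc (0 : ℝ) 1 :=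
  ⟨Finset.prod_pos fun k _ => (cycleLik_mem_Ioc q k h hθ).1,
    Finset.prod_le_one (fun k _ => (cycleLik_mem_Ioc q k h hθ).1.le)
      fun k _ => (cycleLik_mem_Ioc q k h hθ).2⟩

theorem cycleLik_congr {n : ℕ} {h h' : Responses M} (hh : ∀ k ≤ n, h k = h' k) :
    cycleLik q n h = cycleLik q n h' := by
  funext θ
  refine Finset.prod_congr rfl fun m _ => ?_
  rw [hh n le_rfl, q.adapted n m h h' fun k j hk => ?_]
  rcases hk with hk | ⟨rfl, -⟩
  · rw [hh k hk.le]
  · rw [hh k le_rfl]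

theorem lik_congr {n : ℕ} {h h' : Responses M} (hh : ∀ k < n, h k = h' k) :
    lik q n h = lik q n h' := by
  funext θ
  refine Finset.prod_congr rfl fun k hk => ?_
  rw [cycleLik_congr q fun l hl => hh l (hl.trans_lt (Finset.mem_range.1 hk))]

theorem lik_eq_of_samePast {q q' : SeqPolicy d M} {n : ℕ} (hq : SeqPolicy.SamePast n q q') :
    lik q' n = lik q n := by
  funext h θ
  refine Finset.prod_congr rfl fun k hk => ?_
  rw [cycleLik, cycleLik, hq k (Finset.mem_range.1 hk)]

end

/-- A nonnegative integrable density carried by `ℝ^d × (0, 1/2)^M`. -/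
structure IsWeight {d M : ℕ} (f : Param d M → ℝ) : Prop where
  measurable : Measurable f
  nonneg : ∀ θ, 0 ≤ f θ
  integrable : Integrable f
  support : ∀ θ, f θ ≠ 0 → ∀ m, θ.2 m ∈ Set.Ioo (0 : ℝ) (1 / 2)

theorem IsPrior.isWeight {d M : ℕ} {p₀ : Param d M → ℝ} (hp : IsPrior p₀) : IsWeight p₀ where
  measurable := hp.measurable
  nonneg := hp.nonneg
  integrable := by
    -- The Bochner integral of a nonintegrable function is `0`, not `1`.
    by_contra h
    have := hp.integral_eq_one
    rw [integral_undef h] at this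
    exact zero_ne_one this
  support := hp.support

/-- The bound on `ψ` is asked only where `f ≠ 0`, since likelihoods are controlled only for
crossover probabilities in `(0, 1/2)`. -/
theorem IsWeight.mul {d M : ℕ} {f ψ : Param d M → ℝ} (hf : IsWeight f) (hψ : Measurable ψ)
    (h01 : ∀ θ, f θ ≠ 0 → ψ θ ∈ Set.Icc (0 : ℝ) 1) : IsWeight fun θ => f θ * ψ θ where
  measurable := hf.measurable.mul hψ
  nonneg θ := by
    by_cases h : f θ = 0
    · simp [h]
    · exact mul_nonneg (hf.nonneg θ) (h01 θ h).1
  integrable := by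
    refine hf.integrable.mono (hf.measurable.mul hψ).aestronglyMeasurable
      (.of_forall fun θ => ?_)
    by_cases h : f θ = 0
    · simp [h]
    · rw [norm_mul, Real.norm_eq_abs (ψ θ), abs_of_nonneg (h01 θ h).1]
      exact mul_le_of_le_one_right (norm_nonneg _) (h01 θ h).2
  support θ h := hf.support θ (left_ne_zero_of_mul h)

theorem IsWeight.mul_lik {d M : ℕ} {f : Param d M → ℝ} (hf : IsWeight f) (q : SeqPolicy d M)
    (n : ℕ) (h : Responses M) : IsWeight fun θ => f θ * lik q n h θ :=
  hf.mul (measurable_lik q n h) fun θ hθ =>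
    Set.Ioc_subset_Icc_self (lik_mem_Ioc q n h (hf.support θ hθ))

/-! ### Joint law of the parameters and the response history -/

section

variable {d M : ℕ} {Ω : Type*}

/-- If `f` is the density of `T` on the event `E`, and the conditional probability of `F` is
`ψ ∘ T` on `E`, then `f ψ` is the density of `T` on `E ∩ F`. -/
theorem map_restrict_inter_eq_withDensity {m mΩ : MeasurableSpace Ω} {μ : Measure Ω}
    [IsProbabilityMeasure μ] (hm : m ≤ mΩ) {T : Ω → Param d M} (hT : Measurable[m] T)
    {E F : Set Ω} (hE : MeasurableSet[m] E) (hF : MeasurableSet F) {f ψ : Param d M → ℝ}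
    (hf : IsWeight f) (hψ : Measurable ψ) (h01 : ∀ θ, f θ ≠ 0 → ψ θ ∈ Set.Icc (0 : ℝ) 1)
    (hlaw : (μ.restrict E).map T = volume.withDensity fun θ => ENNReal.ofReal (f θ))
    {φ : Ω → ℝ} (hcond : μ⟦F | m⟧ =ᵐ[μ] φ) (hφ : ∀ ω ∈ E, φ ω = ψ (T ω)) :
    (μ.restrict (E ∩ F)).map T = volume.withDensity fun θ => ENNReal.ofReal (f θ * ψ θ) := by
  have hT' : Measurable T := hT.mono hm le_rfl
  have hfψ := hf.mul hψ h01
  ext B hB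
  have hTB : MeasurableSet[m] (T ⁻¹' B) := hT hB
  have hTB' : MeasurableSet (T ⁻¹' B) := hT' hB
  rw [Measure.map_apply hT' hB, Measure.restrict_apply hTB', withDensity_apply _ hB,
    ← ofReal_integral_eq_lintegral_ofReal hfψ.integrable.restrict (.of_forall hfψ.nonneg)]
  have h1 : μ.real (T ⁻¹' B ∩ (E ∩ F)) = ∫ θ in B, f θ * ψ θ := by
    -- `T ⁻¹' B ∩ E` lies in `m`, so the indicator of `F` may be replaced there by its conditional
    -- expectation.
    calc μ.real (T ⁻¹' B ∩ (E ∩ F))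
        = ∫ ω in T ⁻¹' B ∩ E, F.indicator (fun _ => (1 : ℝ)) ω ∂μ := by
          rw [setIntegral_indicator hF, setIntegral_const, smul_eq_mul, mul_one, Set.inter_assoc]
      _ = ∫ ω in T ⁻¹' B ∩ E, (μ⟦F | m⟧) ω ∂μ :=
          (setIntegral_condExp hm ((integrable_const (1 : ℝ)).indicator hF)
            (hTB.inter hE)).symm
      _ = ∫ ω in T ⁻¹' B ∩ E, ψ (T ω) ∂μ := by
          refine setIntegral_congr_ae (hTB'.inter (hm _ hE)) ?_
          filter_upwards [hcond] with ω h hω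
          rw [h, hφ ω hω.2]
      _ = ∫ ω in T ⁻¹' B, ψ (T ω) ∂(μ.restrict E) := by
          rw [Measure.restrict_restrict hTB']
      _ = ∫ θ in B, ψ θ ∂((μ.restrict E).map T) :=
          (setIntegral_map hB hψ.aestronglyMeasurable hT'.aemeasurable).symm
      _ = ∫ θ in B, f θ * ψ θ := by
          rw [hlaw, restrict_withDensity hB, integral_withDensity_eq_integral_toReal_smul
            hf.measurable.ennreal_ofReal (.of_forall fun _ => ENNReal.ofReal_lt_top)]
          simp only [ENNReal.toReal_ofReal (hf.nonneg _), smul_eq_mul]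
  rw [← h1, ofReal_measureReal]

/-- The event that the responses preceding sub-instant `t` of cycle `n` are those of `h`. -/
def cyl (Y : ℕ → Fin M → Ω → Bool) (n t : ℕ) (h : Responses M) : Set Ω :=
  {ω | ∀ k j, Before n t k j → Y k j ω = h k j}

theorem before_zero_iff {n k : ℕ} {j : Fin M} : Before n 0 k j ↔ k < n := by
  simp [Before]

theorem mem_cyl_zero {Y : ℕ → Fin M → Ω → Bool} {n : ℕ} {h : Responses M} {ω : Ω} :
    ω ∈ cyl Y n 0 h ↔ ∀ k < n, resp Y ω k = h k := by
  simp only [cyl, before_zero_iff, Set.mem_ofPred_eq, funext_iff, resp]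
  exact ⟨fun H k hk j => H k j hk, fun H k j hk => H k hk j⟩

theorem cyl_zero (Y : ℕ → Fin M → Ω → Bool) (h : Responses M) : cyl Y 0 0 h = Set.univ := by
  ext ω; simp [cyl, before_zero_iff]

theorem cyl_succ_cycle (Y : ℕ → Fin M → Ω → Bool) (n : ℕ) (h : Responses M) :
    cyl Y (n + 1) 0 h = cyl Y n 0 h ∩ {ω | ∀ m, Y n m ω = h n m} := by
  ext ω
  simp only [Set.mem_inter_iff, mem_cyl_zero, Set.mem_ofPred_eq, Nat.lt_succ_iff_lt_or_eq]
  refine ⟨fun H => ⟨fun k hk => H k (.inl hk), fun m => congrFun (H n (.inr rfl)) m⟩, ?_⟩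
  rintro ⟨H1, H2⟩ k (hk | rfl)
  · exact H1 k hk
  · exact funext H2

theorem cyl_full_cycle (Y : ℕ → Fin M → Ω → Bool) (n : ℕ) (h : Responses M) :
    cyl Y n M h = cyl Y (n + 1) 0 h := by
  ext ω
  refine forall₂_congr fun k j => imp_congr_left ?_
  simp only [Before, j.2, and_true, Nat.not_lt_zero, and_false, or_false]
  omega

theorem cyl_succ_player (Y : ℕ → Fin M → Ω → Bool) (n : ℕ) (m : Fin M) (h : Responses M) :
    cyl Y n (m + 1) h = cyl Y n m h ∩ {ω | Y n m ω = h n m} := by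
  ext ω
  constructor
  · intro H
    refine ⟨fun k j hk => H k j ?_, H n m (.inr ⟨rfl, Nat.lt_succ_self _⟩)⟩
    rcases hk with hk | ⟨hk, hj⟩
    · exact .inl hk
    · exact .inr ⟨hk, hj.trans (Nat.lt_succ_self _)⟩
  · rintro ⟨H1, H2⟩ k j (hk | ⟨rfl, hj⟩)
    · exact H1 k j (.inl hk)
    · rcases Nat.lt_succ_iff_lt_or_eq.1 hj with hj | hj
      · exact H1 k j (.inr ⟨rfl, hj⟩)
      · obtain rfl : j = m := Fin.ext hj
        exact H2

theorem measurableSet_info_cyl (Y : ℕ → Fin M → Ω → Bool) (n t : ℕ) (h : Responses M) :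
    MeasurableSet[info Y n t] (cyl Y n t h) := by
  have : cyl Y n t h = ⋂ (k : ℕ) (j : Fin M) (_ : Before n t k j), Y k j ⁻¹' {h k j} := by
    ext ω; simp [cyl]
  rw [this]
  refine MeasurableSet.iInter fun k => MeasurableSet.iInter fun j => MeasurableSet.iInter
    fun hk => ?_
  have hle : MeasurableSpace.comap (Y k j) ⊤ ≤ info Y n t :=
    le_iSup_of_le k (le_iSup_of_le j (le_iSup_of_le hk le_rfl))
  exact hle _ ⟨_, trivial, rfl⟩

variable [mΩ : MeasurableSpace Ω]

theorem info_le {Y : ℕ → Fin M → Ω → Bool} (hY : ∀ n m, Measurable (Y n m)) (n t : ℕ) :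
    info Y n t ≤ mΩ :=
  iSup_le fun k => iSup_le fun j => iSup_le fun _ => (hY k j).comap_le

theorem fullInfo_le {X : Ω → Target d} {ε : Ω → Fin M → ℝ} {Y : ℕ → Fin M → Ω → Bool}
    (hX : Measurable X) (hε : Measurable ε) (hY : ∀ n m, Measurable (Y n m)) (n t : ℕ) :
    fullInfo X ε Y n t ≤ mΩ :=
  sup_le (hX.prodMk hε).comap_le (info_le hY n t)

/-- Under `μ`, the responses have the likelihood function determined by the policy `q`. -/
structure HasLikelihood (p₀ : Param d M → ℝ) (X : Ω → Target d) (ε : Ω → Fin M → ℝ)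
    (Y : ℕ → Fin M → Ω → Bool) (q : SeqPolicy d M) (μ : Measure Ω) : Prop where
  isProbabilityMeasure : IsProbabilityMeasure μ
  measurable_target : Measurable X
  measurable_crossover : Measurable ε
  measurable_response : ∀ n m, Measurable (Y n m)
  law : ∀ n h, (μ.restrict (cyl Y n 0 h)).map (fun ω => (X ω, ε ω)) =
    volume.withDensity fun θ => ENNReal.ofReal (p₀ θ * lik q n h θ)

/-- Chain rule, by induction over cycles and, inside a cycle, over players. On the cylinder of `h`
the query asked is the one for `h`, by adaptedness. -/
theorem IsSeqScheme.hasLikelihood {p₀ : Param d M → ℝ} (hp : IsPrior p₀) {X : Ω → Target d}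
    {ε : Ω → Fin M → ℝ} {Y : ℕ → Fin M → Ω → Bool} {q : SeqPolicy d M} {μ : Measure Ω}
    (hq : IsSeqScheme p₀ X ε Y q μ) : HasLikelihood p₀ X ε Y q μ where
  isProbabilityMeasure := hq.isProbabilityMeasure
  measurable_target := hq.measurable_target
  measurable_crossover := hq.measurable_crossover
  measurable_response := hq.measurable_response
  law := by
    have := hq.isProbabilityMeasure
    intro n h
    induction n with
    | zero =>
      simp [cyl_zero, lik, hq.prior]
    | succ n ih =>
      have key : ∀ t ≤ M, (μ.restrict (cyl Y n t h)).map (fun ω => (X ω, ε ω)) =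
          volume.withDensity fun θ => ENNReal.ofReal (p₀ θ * lik q n h θ *
            ∏ j ∈ Finset.univ.filter (fun j : Fin M => (j : ℕ) < t), bsc (θ.2 j) (q.query n j h) θ.1 (h n j)) := by
        intro t
        induction t with
        | zero => intro _; simpa using ih
        | succ t iht =>
          intro ht
          let m : Fin M := ⟨t, ht⟩
          have hw := (hp.isWeight.mul_lik q n h).mul
            (ψ := fun θ => ∏ j ∈ Finset.univ.filter (fun j : Fin M => (j : ℕ) < t),
              bsc (θ.2 j) (q.query n j h) θ.1 (h n j))
            (Finset.measurable_prod _ fun j _ =>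
              measurable_bsc (q.measurableSet_query n j h) j (h n j))
            fun θ hθ => Set.Ioc_subset_Icc_self (prod_bsc_mem_Ioc _ _ _
              (hp.support θ (left_ne_zero_of_mul hθ)))
          have hstep := map_restrict_inter_eq_withDensity
            (fullInfo_le hq.measurable_target hq.measurable_crossover hq.measurable_response n m)
            (T := fun ω => (X ω, ε ω))
            (measurable_iff_comap_le.2 (le_sup_left (b := info Y n m)))
            (le_sup_right (a := MeasurableSpace.comap (fun ω => (X ω, ε ω)) inferInstance) _
              (measurableSet_info_cyl Y n m h))
            (hq.measurable_response n m (measurableSet_singleton (h n m))) hw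
            (measurable_bsc (q.measurableSet_query n m h) m (h n m))
            (fun θ hθ => Set.Ioo_subset_Icc_self (bsc_mem_Ioo (hw.support θ hθ m) _ _ _))
            (iht (Nat.le_of_succ_le ht)) (hq.channel n m (h n m)) (fun ω hω => by
              rw [q.adapted n m (resp Y ω) h hω])
          have hc := cyl_succ_player Y n m h
          change cyl Y n (t + 1) h = _ at hc
          rw [hc]
          refine hstep.trans ?_
          congr 1
          funext θ
          rw [mul_assoc]
          congr 2
          have hins : (Finset.univ.filter fun j : Fin M => (j : ℕ) < t + 1) =
              insert m (Finset.univ.filter fun j : Fin M => (j : ℕ) < t) := by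
            ext j
            simp only [Finset.mem_filter, Finset.mem_univ, true_and, Finset.mem_insert, m,
              Fin.ext_iff]
            omega
          rw [hins, Finset.prod_insert (by simp [m]), mul_comm]
      rw [← cyl_full_cycle, key M le_rfl]
      simp only [Fin.is_lt, Finset.filter_true, lik_succ, cycleLik, mul_assoc]

/-- A joint policy is a sequential policy that ignores the responses of the current cycle. -/
def JointPolicy.toSeq (π : JointPolicy d M) : SeqPolicy d M where
  query := π.query
  measurableSet_query := π.measurableSet_query
  adapted n m y y' h := π.adapted n m y y' fun k j hk => h k j (.inl (before_zero_iff.1 hk))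

/-- Conditional independence yields the whole cycle in one step, so only the induction over cycles
remains. -/
theorem IsJointScheme.hasLikelihood {p₀ : Param d M → ℝ} (hp : IsPrior p₀) {X : Ω → Target d}
    {ε : Ω → Fin M → ℝ} {Y : ℕ → Fin M → Ω → Bool} {π : JointPolicy d M} {μ : Measure Ω}
    (hπ : IsJointScheme p₀ X ε Y π μ) : HasLikelihood p₀ X ε Y π.toSeq μ where
  isProbabilityMeasure := hπ.isProbabilityMeasure
  measurable_target := hπ.measurable_target
  measurable_crossover := hπ.measurable_crossover
  measurable_response := hπ.measurable_response
  law := by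
    have := hπ.isProbabilityMeasure
    intro n h
    induction n with
    | zero =>
      simp [cyl_zero, lik, hπ.prior]
    | succ n ih =>
      have hw := hp.isWeight.mul_lik π.toSeq n h
      have hcond : μ⟦{ω | ∀ m, Y n m ω = h n m} | fullInfo X ε Y n 0⟧ =ᵐ[μ]
          fun ω => ∏ m, bsc (ε ω m) (π.query n m (resp Y ω)) (X ω) (h n m) := by
        filter_upwards [hπ.condIndep n (h n),
          ae_all_iff.2 fun m => hπ.channel n m (h n m)] with ω h1 h2
        rw [h1]
        exact Finset.prod_congr rfl fun m _ => h2 m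
      have hF : MeasurableSet {ω | ∀ m, Y n m ω = h n m} :=
        measurableSet_setOfPred.2 (Measurable.forall fun m => measurableSet_setOfPred.1
          (hπ.measurable_response n m (measurableSet_singleton (h n m))))
      have hstep := map_restrict_inter_eq_withDensity
        (fullInfo_le hπ.measurable_target hπ.measurable_crossover hπ.measurable_response n 0)
        (T := fun ω => (X ω, ε ω))
        (measurable_iff_comap_le.2 (le_sup_left (b := info Y n 0)))
        (le_sup_right (a := MeasurableSpace.comap (fun ω => (X ω, ε ω)) inferInstance) _
          (measurableSet_info_cyl Y n 0 h)) hF hw (measurable_cycleLik π.toSeq n h)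
        (fun θ hθ => Set.Ioc_subset_Icc_self (cycleLik_mem_Ioc _ _ _ (hw.support θ hθ)))
        ih hcond (fun ω hω => Finset.prod_congr rfl fun m _ => by
          rw [π.adapted n m (resp Y ω) h hω]; rfl)
      rw [cyl_succ_cycle, hstep]
      simp only [lik_succ, mul_assoc]

end

/-! ### Entropy of the responses of one cycle given the parameters -/

theorem sum_prod_apply_eq_one {ι : Type*} [Fintype ι] [DecidableEq ι] {w : ι → Bool → ℝ}
    (hw : ∀ i, ∑ b, w i b = 1) : ∑ z : ι → Bool, ∏ i, w i (z i) = 1 := by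
  rw [← Fintype.piFinset_univ, ← Finset.prod_univ_sum]
  simp [hw, -Fintype.univ_bool]

/-- Linearity of expectation under a product law: for each summand `g j`, all factors other than the
`j`-th sum to one. -/
theorem sum_prod_apply_mul_sum {ι : Type*} [Fintype ι] [DecidableEq ι] {w : ι → Bool → ℝ}
    (hw : ∀ i, ∑ b, w i b = 1) (g : ι → Bool → ℝ) :
    ∑ z : ι → Bool, (∏ i, w i (z i)) * ∑ i, g i (z i) = ∑ i, ∑ b, w i b * g i b := by
  simp_rw [Finset.mul_sum]
  rw [Finset.sum_comm]
  refine Finset.sum_congr rfl fun j _ => ?_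
  have h1 : ∀ z : ι → Bool, (∏ i, w i (z i)) * g j (z j) =
      ∏ i, w i (z i) * (if i = j then g i (z i) else 1) := by
    intro z
    rw [Finset.prod_mul_distrib, Finset.prod_ite_eq' Finset.univ j fun i => g i (z i)]
    simp
  simp_rw [h1]
  rw [← Fintype.piFinset_univ,
    ← Finset.prod_univ_sum (fun _ : ι => (Finset.univ : Finset Bool))
      (fun i b => w i b * (if i = j then g i b else 1)),
    ← Finset.mul_prod_erase Finset.univ _ (Finset.mem_univ j), Finset.prod_eq_one]
  · simp
  · intro i hi
    simp only [Finset.ne_of_mem_erase hi, if_false, mul_one]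
    exact hw i

section

variable {d M : ℕ} (q : SeqPolicy d M) (n : ℕ) (h : Responses M)

open Classical in
/-- The vector recording which of the answers `y` to the queries of cycle `n` are correct when
the target is `x`. -/
def correctness (x : Target d) (y : Fin M → Bool) : Fin M → Bool :=
  fun m => decide (x ∈ q.query n m (Function.update h n y) ↔ y m = true)

/-- Answers are recovered player by player: once those of earlier players are known, so is the next
query, and its mark then determines the answer. Injectivity suffices on a finite type. -/
theorem bijective_correctness (x : Target d) : Function.Bijective (correctness q n h x) := by
  refine (Finite.injective_iff_bijective).1 fun y y' hyy => ?_
  have key : ∀ r : ℕ, ∀ m : Fin M, (m : ℕ) = r → y m = y' m := by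
    intro r
    induction r using Nat.strong_induction_on with
    | _ r ih =>
      intro m hm
      have hq : q.query n m (Function.update h n y) = q.query n m (Function.update h n y') := by
        refine q.adapted n m _ _ fun k j hk => ?_
        rcases hk with hk | ⟨rfl, hj⟩
        · rw [Function.update_of_ne hk.ne, Function.update_of_ne hk.ne]
        · rw [Function.update_self, Function.update_self]
          exact ih j (hm ▸ hj) j rfl
      have := congrFun hyy m
      simp only [correctness, hq, decide_eq_decide] at this
      rw [Bool.eq_iff_iff]
      tauto
  exact funext fun m => key m m rfl

theorem cycleLik_update (θ : Param d M) (y : Fin M → Bool) :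
    cycleLik q n (Function.update h n y) θ =
      ∏ m, if correctness q n h θ.1 y m then 1 - θ.2 m else θ.2 m := by
  refine Finset.prod_congr rfl fun m _ => ?_
  have hu : Function.update h n y n m = y m := by rw [Function.update_self]
  unfold bsc correctness
  by_cases hc : θ.1 ∈ q.query n m (Function.update h n y) ↔ y m = true
  · rw [if_pos (by rwa [hu]), if_pos (by simpa only [decide_eq_true_eq] using hc)]
  · rw [if_neg (by rwa [hu]), if_neg (by simpa only [decide_eq_true_eq] using hc)]

theorem sum_cycleLik_update (θ : Param d M) :
    ∑ y, cycleLik q n (Function.update h n y) θ = 1 := by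
  simp_rw [cycleLik_update]
  rw [(bijective_correctness q n h θ.1).sum_comp
    fun z => ∏ m, if z m then 1 - θ.2 m else θ.2 m]
  exact sum_prod_apply_eq_one (w := fun m b => if b then 1 - θ.2 m else θ.2 m) fun m => by simp

/-- Reindexing by the correctness vector removes the queries and leaves the entropy of `M`
independent noise bits. -/
theorem sum_cycleLik_mul_logb {θ : Param d M} (hθ : ∀ m, θ.2 m ∈ Set.Ioo (0 : ℝ) (1 / 2)) :
    ∑ y, cycleLik q n (Function.update h n y) θ *
      Real.logb 2 (cycleLik q n (Function.update h n y) θ) = -∑ m, binEntropyBits (θ.2 m) := by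
  simp_rw [cycleLik_update]
  rw [(bijective_correctness q n h θ.1).sum_comp
    fun z => (∏ m, if z m then 1 - θ.2 m else θ.2 m) *
      Real.logb 2 (∏ m, if z m then 1 - θ.2 m else θ.2 m)]
  have hne : ∀ (z : Fin M → Bool) m, (if z m then 1 - θ.2 m else θ.2 m) ≠ 0 := by
    intro z m
    have := hθ m
    split_ifs
    · linarith [this.2]
    · exact this.1.ne'
  simp_rw [Real.logb_prod (s := Finset.univ) _ fun m _ => hne _ m]
  rw [sum_prod_apply_mul_sum (w := fun m b => if b then 1 - θ.2 m else θ.2 m)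
    (fun m => by simp) fun m b => Real.logb 2 (if b then 1 - θ.2 m else θ.2 m),
    ← Finset.sum_neg_distrib]
  refine Finset.sum_congr rfl fun m _ => ?_
  simp [binEntropyBits]

end

/-! ### Entropy inequalities -/

/-- Unnormalized form of "`2^M` outcomes carry at most `M` bits": Jensen for `Real.negMulLog` with
uniform weights. -/
theorem mul_logb_sub_sum_le {ι : Type*} [Fintype ι] {M : ℕ} (hcard : Fintype.card ι = 2 ^ M)
    {Z : ι → ℝ} (hZ : ∀ i, 0 ≤ Z i) :
    (∑ i, Z i) * Real.logb 2 (∑ i, Z i) - ∑ i, Z i * Real.logb 2 (Z i) ≤ M * ∑ i, Z i := by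
  have hN : (0 : ℝ) < 2 ^ M := by positivity
  have hJ := Real.concaveOn_negMulLog.le_map_sum (t := Finset.univ) (w := fun _ : ι =>
    ((2 : ℝ) ^ M)⁻¹) (p := Z) (fun _ _ => by positivity)
    (by simp [hcard]) (fun i _ => hZ i)
  simp only [smul_eq_mul, ← Finset.mul_sum] at hJ
  have hl : 0 < Real.log 2 := Real.log_pos one_lt_two
  have hS : 0 ≤ ∑ i, Z i := Finset.sum_nonneg fun i _ => hZ i
  rcases hS.eq_or_lt with h0 | hpos
  · have : ∀ i, Z i = 0 := fun i =>
      (Finset.sum_eq_zero_iff_of_nonneg fun i _ => hZ i).1 h0.symm i (Finset.mem_univ i)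
    simp [this]
  · rw [Real.negMulLog, Real.log_mul (by positivity) hpos.ne', Real.log_inv, Real.log_pow] at hJ
    have h2 := mul_le_mul_of_nonneg_left hJ hN.le
    rw [← mul_assoc, mul_inv_cancel₀ hN.ne', one_mul] at h2
    have h3 : (2 : ℝ) ^ M * (-((2 ^ M)⁻¹ * ∑ i, Z i) * (-(M * Real.log 2) +
        Real.log (∑ i, Z i))) = (∑ i, Z i) * (M * Real.log 2 - Real.log (∑ i, Z i)) := by
      field_simp; ring
    rw [h3] at h2
    simp only [Real.negMulLog, neg_mul, Finset.sum_neg_distrib] at h2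
    simp only [Real.logb, mul_div_assoc', ← Finset.sum_div]
    rw [← sub_div, div_le_iff₀ hl]
    linarith

/-- The uniform vector is the equality case of the preceding bound; `0 < S` keeps the logarithm
continuous there. -/
theorem tendsto_mul_logb_sub_sum {ι : Type*} [Fintype ι] {M : ℕ}
    (hcard : Fintype.card ι = 2 ^ M) {S : ℝ} (hS : 0 < S) {Z : ℕ → ι → ℝ}
    (hZ : ∀ i, Tendsto (fun k => Z k i) atTop (𝓝 ((1 / 2) ^ M * S))) :
    Tendsto (fun k => S * Real.logb 2 S - ∑ i, Z k i * Real.logb 2 (Z k i)) atTop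
      (𝓝 (M * S)) := by
  have hl : Real.log 2 ≠ 0 := (Real.log_pos one_lt_two).ne'
  have hpos : (1 / 2 : ℝ) ^ M * S ≠ 0 := by positivity
  have h1 : ∀ i, Tendsto (fun k => Z k i * Real.logb 2 (Z k i)) atTop
      (𝓝 ((1 / 2) ^ M * S * Real.logb 2 ((1 / 2) ^ M * S))) := fun i =>
    (hZ i).mul (((Real.continuousAt_log hpos).tendsto.comp (hZ i)).div_const _)
  convert tendsto_const_nhds.sub (tendsto_finsetSum Finset.univ fun i _ => h1 i) using 2
  rw [Finset.sum_const, Finset.card_univ, hcard, nsmul_eq_mul, Real.logb, Real.logb,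
    Real.log_mul (by positivity) hS.ne', Real.log_pow, one_div, Real.log_inv]
  push_cast
  rw [inv_pow]
  field_simp
  ring

/-! ### Differential entropy of densities -/

section

variable {d M : ℕ}

/-- Split `log (f ψ) = log f + log ψ`: the first part is dominated by `f log f`, and `ψ log₂ ψ` is
bounded by `1 / log 2` on `(0, 1]`. -/
theorem integrable_mul_logb_mul {f ψ : Param d M → ℝ} (hf : IsWeight f)
    (hlog : Integrable fun θ => f θ * Real.logb 2 (f θ)) (hψ : Measurable ψ)
    (h01 : ∀ θ, f θ ≠ 0 → ψ θ ∈ Set.Ioc (0 : ℝ) 1) :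
    Integrable (fun θ => f θ * (ψ θ * Real.logb 2 (ψ θ))) ∧
      Integrable fun θ => f θ * ψ θ * Real.logb 2 (f θ * ψ θ) := by
  have hm : Measurable fun θ => Real.logb 2 (ψ θ) := (Real.measurable_log.comp hψ).div_const _
  have hl : 0 < Real.log 2 := Real.log_pos one_lt_two
  have i1 : Integrable fun θ => f θ * (ψ θ * Real.logb 2 (ψ θ)) := by
    refine (hf.integrable.mul_const (Real.log 2)⁻¹).mono
      (hf.measurable.mul (hψ.mul hm)).aestronglyMeasurable (.of_forall fun θ => ?_)
    by_cases h : f θ = 0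
    · simp [h]
    · rw [norm_mul, norm_mul (f θ) (Real.log 2)⁻¹]
      refine mul_le_mul_of_nonneg_left ?_ (norm_nonneg _)
      have := (Real.abs_log_mul_self_lt (ψ θ) (h01 θ h).1 (h01 θ h).2).le
      rw [Real.logb, mul_div_assoc', norm_div, mul_comm, Real.norm_eq_abs, Real.norm_eq_abs,
        Real.norm_eq_abs, abs_inv, abs_of_pos hl, inv_eq_one_div]
      gcongr
  refine ⟨i1, ?_⟩
  have i2 : Integrable fun θ => f θ * Real.logb 2 (f θ) * ψ θ := by
    refine hlog.mono (hlog.aestronglyMeasurable.mul hψ.aestronglyMeasurable)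
      (.of_forall fun θ => ?_)
    by_cases h : f θ = 0
    · simp [h]
    · rw [norm_mul, Real.norm_eq_abs (ψ θ), abs_of_pos (h01 θ h).1]
      exact mul_le_of_le_one_right (norm_nonneg _) (h01 θ h).2
  refine (i2.add i1).congr (.of_forall fun θ => ?_)
  by_cases h : f θ = 0
  · simp [h]
  · simp only [Pi.add_apply]
    rw [Real.logb_mul h (h01 θ h).1.ne']
    ring

/-- Multiplying by the mass keeps the identity valid on null atoms, where both sides vanish whatever
`ν` is. -/
theorem integral_mul_diffEntropy {f : Param d M → ℝ} (hf : IsWeight f)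
    (hlog : Integrable fun θ => f θ * Real.logb 2 (f θ)) {ν : Measure (Param d M)}
    (hν : 0 < ∫ θ, f θ →
      ν = volume.withDensity fun θ => ENNReal.ofReal (f θ / ∫ θ, f θ)) :
    (∫ θ, f θ) * diffEntropy ν =
      (∫ θ, f θ) * Real.logb 2 (∫ θ, f θ) - ∫ θ, f θ * Real.logb 2 (f θ) := by
  have h0 : 0 ≤ ∫ θ, f θ := integral_nonneg hf.nonneg
  rcases h0.eq_or_lt with h | hpos
  · rw [← h]
    have hz : f =ᵐ[volume] 0 :=
      (integral_eq_zero_iff_of_nonneg hf.nonneg hf.integrable).1 h.symm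
    have : ∫ θ, f θ * Real.logb 2 (f θ) = 0 := by
      rw [← integral_zero (Param d M) ℝ]
      refine integral_congr_ae ?_
      filter_upwards [hz] with θ hθ
      simp [hθ]
    simp [this]
  · set Z := ∫ θ, f θ with hZ
    have hrn := Measure.rnDeriv_withDensity (volume : Measure (Param d M))
      (hf.measurable.div_const Z).ennreal_ofReal
    rw [← hν hpos] at hrn
    have e1 : ∫ θ, (ν.rnDeriv volume θ).toReal * Real.logb 2 (ν.rnDeriv volume θ).toReal =
        ∫ θ, Z⁻¹ * (f θ * Real.logb 2 (f θ)) - Z⁻¹ * Real.logb 2 Z * f θ := by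
      refine integral_congr_ae ?_
      filter_upwards [hrn] with θ hθ
      rw [hθ, ENNReal.toReal_ofReal (div_nonneg (hf.nonneg θ) hpos.le)]
      by_cases h : f θ = 0
      · simp [h]
      · rw [Real.logb_div h hpos.ne']
        ring
    rw [diffEntropy, e1, integral_sub (hlog.const_mul _) (hf.integrable.const_mul _),
      integral_const_mul, integral_const_mul, ← hZ]
    field_simp
    ring

/-- The loss of (unnormalized) differential entropy caused by the responses of a cycle. -/
theorem integral_mul_logb_cycle (q : SeqPolicy d M) (n : ℕ) (h : Responses M)
    {f : Param d M → ℝ} (hf : IsWeight f) (hlog : Integrable fun θ => f θ * Real.logb 2 (f θ)) :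
    ∑ y, ∫ θ, f θ * cycleLik q n (Function.update h n y) θ *
        Real.logb 2 (f θ * cycleLik q n (Function.update h n y) θ) =
      (∫ θ, f θ * Real.logb 2 (f θ)) - ∫ θ, f θ * ∑ m, binEntropyBits (θ.2 m) := by
  have hI := fun y => integrable_mul_logb_mul hf hlog
    (measurable_cycleLik q n (Function.update h n y))
    fun θ hθ => cycleLik_mem_Ioc q n _ (hf.support θ hθ)
  have hB : ∀ θ, f θ * ∑ m, binEntropyBits (θ.2 m) =
      -∑ y, f θ * (cycleLik q n (Function.update h n y) θ *
        Real.logb 2 (cycleLik q n (Function.update h n y) θ)) := by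
    intro θ
    by_cases hθ : f θ = 0
    · simp [hθ]
    · rw [← Finset.mul_sum, sum_cycleLik_mul_logb q n h (hf.support θ hθ)]
      ring
  have hBI : Integrable fun θ => f θ * ∑ m, binEntropyBits (θ.2 m) := by
    simp_rw [hB]
    exact (integrable_finsetSum _ fun y _ => (hI y).1).neg
  rw [← integral_finsetSum _ fun y _ => (hI y).2, ← integral_sub hlog hBI]
  refine integral_congr_ae (.of_forall fun θ => ?_)
  simp only
  rw [hB]
  by_cases hθ : f θ = 0
  · simp [hθ]
  · have : ∀ y, f θ * cycleLik q n (Function.update h n y) θ *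
        Real.logb 2 (f θ * cycleLik q n (Function.update h n y) θ) =
        f θ * Real.logb 2 (f θ) * cycleLik q n (Function.update h n y) θ +
          f θ * (cycleLik q n (Function.update h n y) θ *
            Real.logb 2 (cycleLik q n (Function.update h n y) θ)) := by
      intro y
      rw [Real.logb_mul hθ (cycleLik_mem_Ioc q n _ (hf.support θ hθ)).1.ne']
      ring
    simp_rw [this]
    rw [Finset.sum_add_distrib, ← Finset.mul_sum, sum_cycleLik_update]
    ring

end

/-! ### Conditioning on the response history -/

section

variable {d M : ℕ} {Ω : Type*}

/-- The finite table of the responses of the cycles before `n`. -/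
def hist (Y : ℕ → Fin M → Ω → Bool) (n : ℕ) (ω : Ω) : Fin n → Fin M → Bool :=
  fun k => resp Y ω k

/-- Extension of a finite table of responses to an infinite one. -/
def extendHist {n : ℕ} (a : Fin n → Fin M → Bool) : Responses M :=
  fun k => if hk : k < n then a ⟨k, hk⟩ else fun _ => false

theorem extendHist_hist (Y : ℕ → Fin M → Ω → Bool) {n k : ℕ} (hk : k < n) (ω : Ω) :
    extendHist (hist Y n ω) k = resp Y ω k := by
  simp [extendHist, hist, hk]

theorem cyl_congr (Y : ℕ → Fin M → Ω → Bool) {n : ℕ} {h h' : Responses M}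
    (hh : ∀ k < n, h k = h' k) : cyl Y n 0 h = cyl Y n 0 h' := by
  ext ω
  simp only [mem_cyl_zero]
  exact forall₂_congr fun k hk => by rw [hh k hk]

theorem mem_cyl_resp (Y : ℕ → Fin M → Ω → Bool) (n : ℕ) (ω : Ω) :
    ω ∈ cyl Y n 0 (resp Y ω) :=
  fun _ _ _ => rfl

theorem hist_eq_of_mem_cyl {Y : ℕ → Fin M → Ω → Bool} {n : ℕ} {ω ω' : Ω}
    (hω : ω' ∈ cyl Y n 0 (resp Y ω)) : hist Y n ω' = hist Y n ω :=
  funext fun k => mem_cyl_zero.1 hω k k.2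

theorem iUnion_cyl_update (Y : ℕ → Fin M → Ω → Bool) (n : ℕ) (h : Responses M) :
    ⋃ y, cyl Y (n + 1) 0 (Function.update h n y) = cyl Y n 0 h := by
  ext ω
  simp only [Set.mem_iUnion, mem_cyl_zero]
  constructor
  · rintro ⟨y, hy⟩ k hk
    rw [hy k (hk.trans (Nat.lt_succ_self n)), Function.update_of_ne hk.ne]
  · intro H
    refine ⟨resp Y ω n, fun k hk => ?_⟩
    rcases Nat.lt_succ_iff_lt_or_eq.1 hk with hk | rfl
    · rw [Function.update_of_ne hk.ne, H k hk]
    · rw [Function.update_self]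

theorem pairwise_disjoint_cyl_update (Y : ℕ → Fin M → Ω → Bool) (n : ℕ) (h : Responses M) :
    Pairwise (Function.onFun Disjoint fun y => cyl Y (n + 1) 0 (Function.update h n y)) := by
  intro y y' hyy
  refine Set.disjoint_left.2 fun ω h1 h2 => hyy ?_
  have e1 := mem_cyl_zero.1 h1 n (Nat.lt_succ_self n)
  have e2 := mem_cyl_zero.1 h2 n (Nat.lt_succ_self n)
  rw [Function.update_self] at e1 e2
  exact e1.symm.trans e2

/-- Every set of `info Y n 0` is a preimage under `hist Y n`; apply this to the level set of `F`
through `ω`. -/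
theorem eq_of_mem_cyl_of_measurable {Y : ℕ → Fin M → Ω → Bool} {n : ℕ} {F : Ω → ℝ}
    (hF : Measurable[info Y n 0] F) {ω ω' : Ω} (hω : ω' ∈ cyl Y n 0 (resp Y ω)) :
    F ω' = F ω := by
  have hle : info Y n 0 ≤ MeasurableSpace.comap (hist Y n) ⊤ := by
    refine iSup_le fun k => iSup_le fun j => iSup_le fun hk => ?_
    have hk := before_zero_iff.1 hk
    rintro s ⟨t, -, rfl⟩
    exact ⟨{a | a ⟨k, hk⟩ j ∈ t}, trivial, rfl⟩
  obtain ⟨S, -, hS⟩ := hle _ (hF (measurableSet_singleton (F ω)))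
  have h1 : ω ∈ hist Y n ⁻¹' S := by rw [hS]; rfl
  have h2 : ω' ∈ hist Y n ⁻¹' S := by
    rw [Set.mem_preimage, hist_eq_of_mem_cyl hω]; exact h1
  rw [hS] at h2
  exact h2

variable [mΩ : MeasurableSpace Ω]

theorem measurable_hist {Y : ℕ → Fin M → Ω → Bool} (hY : ∀ n m, Measurable (Y n m)) (n : ℕ) :
    Measurable (hist Y n) :=
  measurable_pi_lambda _ fun k => measurable_pi_lambda _ fun j => hY k j

theorem measurableSet_cyl {Y : ℕ → Fin M → Ω → Bool} (hY : ∀ n m, Measurable (Y n m)) (n : ℕ)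
    (h : Responses M) : MeasurableSet (cyl Y n 0 h) :=
  info_le hY n 0 _ (measurableSet_info_cyl Y n 0 h)

/-- The function factors through the finite type of histories, so `D` needs neither measurability
nor a bound. The default answers in `extendHist` are invisible to `D`. -/
theorem integrable_of_cyl_const {μ : Measure Ω} [IsFiniteMeasure μ] {Y : ℕ → Fin M → Ω → Bool}
    (hY : ∀ n m, Measurable (Y n m)) (n : ℕ) {D : Responses M → ℝ}
    (hD : ∀ h h', (∀ k < n, h k = h' k) → D h = D h') :
    Integrable (fun ω => D (resp Y ω)) μ := by
  have : Integrable (D ∘ extendHist) (μ.map (hist Y n)) := Integrable.of_finite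
  refine (this.comp_measurable (measurable_hist hY n)).congr (.of_forall fun ω => ?_)
  exact hD _ _ fun k hk => extendHist_hist Y hk ω

theorem setIntegral_cyl_const {μ : Measure Ω} {Y : ℕ → Fin M → Ω → Bool}
    (hY : ∀ n m, Measurable (Y n m)) (n : ℕ) {D : Responses M → ℝ}
    (hD : ∀ h h', (∀ k < n, h k = h' k) → D h = D h') (h : Responses M) :
    ∫ ω in cyl Y n 0 h, D (resp Y ω) ∂μ = μ.real (cyl Y n 0 h) * D h := by
  rw [setIntegral_congr_fun (measurableSet_cyl hY n h) (g := fun _ => D h)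
    fun ω hω => hD _ _ (mem_cyl_zero.1 hω), setIntegral_const, smul_eq_mul]

theorem ae_measureReal_cyl_pos (μ : Measure Ω) [IsFiniteMeasure μ] (Y : ℕ → Fin M → Ω → Bool)
    (n : ℕ) : ∀ᵐ ω ∂μ, 0 < μ.real (cyl Y n 0 (resp Y ω)) := by
  have h1 : ∀ a : Fin n → Fin M → Bool, ∀ᵐ ω ∂μ,
      ω ∈ cyl Y n 0 (extendHist a) → 0 < μ.real (cyl Y n 0 (extendHist a)) := by
    intro a
    by_cases h0 : μ (cyl Y n 0 (extendHist a)) = 0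
    · filter_upwards [measure_eq_zero_iff_ae_notMem.1 h0] with ω hω h
      exact absurd h hω
    · exact .of_forall fun _ _ => ENNReal.toReal_pos h0 (measure_ne_top _ _)
  filter_upwards [ae_all_iff.2 h1] with ω hω
  have e : cyl Y n 0 (extendHist (hist Y n ω)) = cyl Y n 0 (resp Y ω) :=
    cyl_congr Y fun k hk => extendHist_hist Y hk ω
  have := hω (hist Y n ω)
  rw [e] at this
  exact this (mem_cyl_resp Y n ω)

/-- The conditional expectation is constant on atoms. The product form therefore holds at every `ω`,
null atoms included, which later permits comparing different measures pointwise. -/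
theorem condExp_info_mul_measureReal {μ : Measure Ω} [IsFiniteMeasure μ]
    {Y : ℕ → Fin M → Ω → Bool} (hY : ∀ n m, Measurable (Y n m)) (n : ℕ) {G : Ω → ℝ}
    (hG : Integrable G μ) (ω : Ω) :
    (μ[G | info Y n 0]) ω * μ.real (cyl Y n 0 (resp Y ω)) =
      ∫ ω' in cyl Y n 0 (resp Y ω), G ω' ∂μ := by
  rw [← setIntegral_condExp (info_le hY n 0) hG (measurableSet_info_cyl Y n 0 (resp Y ω)),
    setIntegral_congr_fun (measurableSet_cyl hY n _) (g := fun _ => (μ[G | info Y n 0]) ω)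
      fun ω' hω' => eq_of_mem_cyl_of_measurable stronglyMeasurable_condExp.measurable hω',
    setIntegral_const, smul_eq_mul, mul_comm]

end

/-! ### Capacities -/

theorem binEntropyBits_eq (e : ℝ) : binEntropyBits e = Real.binEntropy e / Real.log 2 := by
  simp only [binEntropyBits, Real.binEntropy, Real.logb, Real.log_inv]
  ring

theorem measurable_capacity : Measurable capacity := by
  unfold capacity
  simp_rw [binEntropyBits_eq]
  exact measurable_const.sub (Real.binEntropy_continuous.measurable.div_const _)

theorem capacity_mem_Icc {e : ℝ} (he : e ∈ Set.Ioo (0 : ℝ) (1 / 2)) :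
    capacity e ∈ Set.Icc (0 : ℝ) 1 := by
  have hl : 0 < Real.log 2 := Real.log_pos one_lt_two
  have h1 : 0 ≤ Real.binEntropy e := Real.binEntropy_nonneg he.1.le (by linarith [he.2])
  have h2 : Real.binEntropy e ≤ Real.log 2 := Real.binEntropy_le_log_two
  rw [capacity, binEntropyBits_eq]
  exact ⟨sub_nonneg.2 ((div_le_one hl).2 h2), sub_le_self _ (div_nonneg h1 hl.le)⟩

theorem IsWeight.integrable_mul_sum_capacity {d M : ℕ} {f : Param d M → ℝ} (hf : IsWeight f) :
    Integrable fun θ => f θ * ∑ m, capacity (θ.2 m) := by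
  simp_rw [Finset.mul_sum]
  refine integrable_finsetSum _ fun m _ => (hf.mul (ψ := fun θ => capacity (θ.2 m)) ?_ ?_).integrable
  · exact measurable_capacity.comp ((measurable_pi_apply m).comp measurable_snd)
  · exact fun θ hθ => capacity_mem_Icc (hf.support θ hθ m)

theorem IsWeight.integral_mul_sum_capacity {d M : ℕ} {f : Param d M → ℝ} (hf : IsWeight f) :
    ∫ θ, f θ * ∑ m, capacity (θ.2 m) =
      M * (∫ θ, f θ) - ∫ θ, f θ * ∑ m, binEntropyBits (θ.2 m) := by
  have e : ∀ θ, f θ * ∑ m, binEntropyBits (θ.2 m) =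
      M * f θ - f θ * ∑ m, capacity (θ.2 m) := by
    intro θ
    simp only [capacity, Finset.sum_sub_distrib, Finset.sum_const, Finset.card_univ,
      Fintype.card_fin, nsmul_eq_mul]
    ring
  simp_rw [e]
  rw [integral_sub (hf.integrable.const_mul _) hf.integrable_mul_sum_capacity, integral_const_mul]
  ring

theorem measurable_sum_capacity {d M : ℕ} :
    Measurable fun θ : Param d M => ∑ m, capacity (θ.2 m) :=
  Finset.measurable_sum _ fun m _ =>
    measurable_capacity.comp ((measurable_pi_apply m).comp measurable_snd)

/-! ### Entropy loss on the atoms of the response history -/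

namespace HasLikelihood

variable {d M : ℕ} {Ω : Type*} [mΩ : MeasurableSpace Ω] {p₀ : Param d M → ℝ}
  {X : Ω → Target d} {ε : Ω → Fin M → ℝ} {Y : ℕ → Fin M → Ω → Bool} {q : SeqPolicy d M}
  {μ : Measure Ω}

theorem measure_cyl (H : HasLikelihood p₀ X ε Y q μ) (hp : IsPrior p₀) (n : ℕ)
    (h : Responses M) : μ (cyl Y n 0 h) = ENNReal.ofReal (∫ θ, p₀ θ * lik q n h θ) := by
  have hT := H.measurable_target.prodMk H.measurable_crossover
  have hw := hp.isWeight.mul_lik q n h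
  have := congrArg (fun ν : Measure (Param d M) => ν Set.univ) (H.law n h)
  simp only [Measure.map_apply hT .univ, Set.preimage_univ, Measure.restrict_apply_univ,
    withDensity_apply _ MeasurableSet.univ, Measure.restrict_univ] at this
  rw [this, ofReal_integral_eq_lintegral_ofReal hw.integrable (.of_forall hw.nonneg)]

theorem measureReal_cyl (H : HasLikelihood p₀ X ε Y q μ) (hp : IsPrior p₀) (n : ℕ)
    (h : Responses M) : μ.real (cyl Y n 0 h) = ∫ θ, p₀ θ * lik q n h θ := by
  rw [measureReal_def, H.measure_cyl hp,
    ENNReal.toReal_ofReal (integral_nonneg (hp.isWeight.mul_lik q n h).nonneg)]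

theorem setIntegral_cyl_comp (H : HasLikelihood p₀ X ε Y q μ) (hp : IsPrior p₀) (n : ℕ)
    (h : Responses M) {G : Param d M → ℝ} (hG : Measurable G) :
    ∫ ω in cyl Y n 0 h, G (X ω, ε ω) ∂μ = ∫ θ, p₀ θ * lik q n h θ * G θ := by
  have hT := H.measurable_target.prodMk H.measurable_crossover
  have hw := hp.isWeight.mul_lik q n h
  rw [← integral_map (φ := fun ω => (X ω, ε ω)) hT.aemeasurable hG.aestronglyMeasurable, H.law,
    integral_withDensity_eq_integral_toReal_smul hw.measurable.ennreal_ofReal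
      (.of_forall fun _ => ENNReal.ofReal_lt_top)]
  simp only [ENNReal.toReal_ofReal (hw.nonneg _), smul_eq_mul]

theorem integral_comp (H : HasLikelihood p₀ X ε Y q μ) (hp : IsPrior p₀) {G : Param d M → ℝ}
    (hG : Measurable G) : ∫ ω, G (X ω, ε ω) ∂μ = ∫ θ, p₀ θ * G θ := by
  have := H.setIntegral_cyl_comp hp 0 (fun _ _ => false) hG
  simpa [cyl_zero, lik] using this

theorem integrable_sum_capacity (H : HasLikelihood p₀ X ε Y q μ) (hp : IsPrior p₀) :
    Integrable (fun ω => ∑ m, capacity (ε ω m)) μ := by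
  have hT := H.measurable_target.prodMk H.measurable_crossover
  have hw := hp.isWeight
  have hlaw := H.law 0 (fun _ _ => false)
  simp only [cyl_zero, Measure.restrict_univ, lik, Finset.range_zero, Finset.prod_empty,
    mul_one] at hlaw
  have : Integrable (fun θ : Param d M => ∑ m, capacity (θ.2 m))
      (μ.map fun ω => (X ω, ε ω)) := by
    rw [hlaw, integrable_withDensity_iff_integrable_smul' hw.measurable.ennreal_ofReal
      (.of_forall fun _ => ENNReal.ofReal_lt_top)]
    simpa only [ENNReal.toReal_ofReal (hw.nonneg _), smul_eq_mul] using
      hw.integrable_mul_sum_capacity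
  exact this.comp_measurable hT

/-- Bayes' rule: on an atom of positive mass the posterior density is the prior times the
likelihood, normalized. -/
theorem measureReal_mul_diffEntropy (H : HasLikelihood p₀ X ε Y q μ) (hp : IsPrior p₀) (n : ℕ)
    (h : Responses M) :
    (∫ θ, p₀ θ * lik q n h θ) *
        diffEntropy ((ProbabilityTheory.cond μ (cyl Y n 0 h)).map fun ω => (X ω, ε ω)) =
      (∫ θ, p₀ θ * lik q n h θ) * Real.logb 2 (∫ θ, p₀ θ * lik q n h θ) -
        ∫ θ, p₀ θ * lik q n h θ * Real.logb 2 (p₀ θ * lik q n h θ) := by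
  have hw := hp.isWeight.mul_lik q n h
  refine integral_mul_diffEntropy hw (integrable_mul_logb_mul hp.isWeight hp.finite_entropy
    (measurable_lik q n h) fun θ hθ => lik_mem_Ioc q n h (hp.support θ hθ)).2 fun hpos => ?_
  rw [ProbabilityTheory.cond, Measure.map_smul, H.law, H.measure_cyl hp,
    ← withDensity_smul _ hw.measurable.ennreal_ofReal]
  congr 1
  funext θ
  rw [Pi.smul_apply, smul_eq_mul, ← ENNReal.ofReal_inv_of_pos hpos,
    ← ENNReal.ofReal_mul (inv_nonneg.2 hpos.le), inv_mul_eq_div]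

theorem lik_update (q : SeqPolicy d M) (n : ℕ) (h : Responses M) (y : Fin M → Bool)
    (θ : Param d M) : lik q (n + 1) (Function.update h n y) θ =
      lik q n h θ * cycleLik q n (Function.update h n y) θ := by
  rw [lik_succ, lik_congr q (h := Function.update h n y) (h' := h)
    fun k hk => Function.update_of_ne hk.ne _ _]

/-- Expected entropy loss on an atom of the response history. -/
theorem cycleLoss_mul (H : HasLikelihood p₀ X ε Y q μ) (hp : IsPrior p₀) (n : ℕ) (ω : Ω) :
    cycleLoss X ε Y μ n ω * ∫ θ, p₀ θ * lik q n (resp Y ω) θ =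
      (∫ θ, p₀ θ * lik q n (resp Y ω) θ) * Real.logb 2 (∫ θ, p₀ θ * lik q n (resp Y ω) θ) -
      (∑ y, (∫ θ, p₀ θ * lik q (n + 1) (Function.update (resp Y ω) n y) θ) *
        Real.logb 2 (∫ θ, p₀ θ * lik q (n + 1) (Function.update (resp Y ω) n y) θ)) -
      ∫ θ, p₀ θ * lik q n (resp Y ω) θ * ∑ m, binEntropyBits (θ.2 m) := by
  have := H.isProbabilityMeasure
  have hY := H.measurable_response
  set h := resp Y ω with hh
  let D : ℕ → Responses M → ℝ := fun n h =>
    diffEntropy ((ProbabilityTheory.cond μ (cyl Y n 0 h)).map fun ω => (X ω, ε ω))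
  have hD : ∀ n h h', (∀ k < n, h k = h' k) → D n h = D n h' := fun n h h' hk => by
    simp only [D, cyl_congr Y hk]
  have hpost : ∀ n ω', diffEntropy (posterior X ε Y μ n ω') = D n (resp Y ω') := by
    intro n ω'
    have : {ω'' | ∀ k < n, ∀ m, Y k m ω'' = Y k m ω'} = cyl Y n 0 (resp Y ω') := by
      ext ω''
      simp only [mem_cyl_zero, funext_iff]
      rfl
    simp only [posterior, D, this]
  have hI : ∀ n, Integrable (fun ω => D n (resp Y ω)) μ := fun n =>
    integrable_of_cyl_const hY n (hD n)
  have hw := hp.isWeight.mul_lik q n h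
  have hlog : Integrable fun θ => p₀ θ * lik q n h θ * Real.logb 2 (p₀ θ * lik q n h θ) :=
    (integrable_mul_logb_mul hp.isWeight hp.finite_entropy
      (measurable_lik q n h) fun θ hθ => lik_mem_Ioc q n h (hp.support θ hθ)).2
  -- Integrate over the atom, which splits into the atoms of the next cycle, one for each answer
  -- vector.
  have e1 : cycleLoss X ε Y μ n ω * ∫ θ, p₀ θ * lik q n h θ =
      (∫ θ, p₀ θ * lik q n h θ) * D n h - ∑ y,
        (∫ θ, p₀ θ * lik q (n + 1) (Function.update h n y) θ) *
          D (n + 1) (Function.update h n y) := by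
    unfold cycleLoss
    simp_rw [hpost]
    rw [← H.measureReal_cyl hp, condExp_info_mul_measureReal hY n
      (G := fun ω => D n (resp Y ω) - D (n + 1) (resp Y ω)) ((hI n).sub (hI (n + 1))),
      integral_sub (hI n).restrict (hI (n + 1)).restrict, setIntegral_cyl_const hY n (hD n)]
    congr 1
    rw [← hh, ← iUnion_cyl_update, integral_iUnion_fintype (fun y => measurableSet_cyl hY _ _)
      (pairwise_disjoint_cyl_update Y n h) fun y => (hI (n + 1)).integrableOn]
    refine Finset.sum_congr rfl fun y _ => ?_
    rw [setIntegral_cyl_const hY (n + 1) (hD (n + 1)), H.measureReal_cyl hp]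
  -- The `∫ f log f` terms before and after the cycle differ exactly by the noise entropy; the
  -- masses supply the answer entropy.
  have e2 := integral_mul_logb_cycle q n h hw hlog
  rw [e1, H.measureReal_mul_diffEntropy hp,
    Finset.sum_congr rfl fun y _ => H.measureReal_mul_diffEntropy hp (n + 1) _,
    Finset.sum_sub_distrib]
  simp only [mul_assoc] at e2
  simp only [lik_update, mul_assoc, e2]
  ring

theorem condExp_sum_capacity_mul (H : HasLikelihood p₀ X ε Y q μ) (hp : IsPrior p₀) (n : ℕ)
    (ω : Ω) :
    (μ[fun ω => ∑ m, capacity (ε ω m) | info Y n 0]) ω * ∫ θ, p₀ θ * lik q n (resp Y ω) θ =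
      M * (∫ θ, p₀ θ * lik q n (resp Y ω) θ) -
        ∫ θ, p₀ θ * lik q n (resp Y ω) θ * ∑ m, binEntropyBits (θ.2 m) := by
  have := H.isProbabilityMeasure
  rw [← (hp.isWeight.mul_lik q n (resp Y ω)).integral_mul_sum_capacity, ← H.measureReal_cyl hp,
    condExp_info_mul_measureReal H.measurable_response n (H.integrable_sum_capacity hp)]
  exact H.setIntegral_cyl_comp hp n _ measurable_sum_capacity

theorem sum_integral_lik_update (hp : IsPrior p₀) (q : SeqPolicy d M) (n : ℕ)
    (h : Responses M) :
    ∑ y, ∫ θ, p₀ θ * lik q (n + 1) (Function.update h n y) θ = ∫ θ, p₀ θ * lik q n h θ := by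
  rw [← integral_finsetSum _ fun y _ => (hp.isWeight.mul_lik q (n + 1) _).integrable]
  simp_rw [lik_update, ← mul_assoc, ← Finset.mul_sum, sum_cycleLik_update, mul_one]

/-- On the atoms of positive probability the expected entropy loss is at most the conditional
expectation of the total capacity. -/
theorem cycleLoss_le (H : HasLikelihood p₀ X ε Y q μ) (hp : IsPrior p₀) (n : ℕ) {ω : Ω}
    (hω : 0 < ∫ θ, p₀ θ * lik q n (resp Y ω) θ) :
    cycleLoss X ε Y μ n ω ≤ (μ[fun ω => ∑ m, capacity (ε ω m) | info Y n 0]) ω := by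
  refine le_of_mul_le_mul_right ?_ hω
  rw [H.cycleLoss_mul hp, H.condExp_sum_capacity_mul hp]
  have := mul_logb_sub_sum_le (ι := Fin M → Bool) (M := M) (by simp)
    (Z := fun y => ∫ θ, p₀ θ * lik q (n + 1) (Function.update (resp Y ω) n y) θ)
    fun y => integral_nonneg (hp.isWeight.mul_lik q (n + 1) _).nonneg
  rw [sum_integral_lik_update hp] at this
  linarith

theorem ae_integral_lik_pos (H : HasLikelihood p₀ X ε Y q μ) (hp : IsPrior p₀) (n : ℕ) :
    ∀ᵐ ω ∂μ, 0 < ∫ θ, p₀ θ * lik q n (resp Y ω) θ := by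
  have := H.isProbabilityMeasure
  filter_upwards [ae_measureReal_cyl_pos μ Y n] with ω hω
  rwa [← H.measureReal_cyl hp]

/-- Measures whose policies agree in the past give the same conditional expectation of the total
capacity on every atom of positive probability. -/
theorem condExp_sum_capacity_eq {q' : SeqPolicy d M} {μ' : Measure Ω}
    (H : HasLikelihood p₀ X ε Y q μ) (H' : HasLikelihood p₀ X ε Y q' μ') (hp : IsPrior p₀)
    {n : ℕ} (hq : SeqPolicy.SamePast n q q') {ω : Ω}
    (hω : 0 < ∫ θ, p₀ θ * lik q n (resp Y ω) θ) :
    (μ'[fun ω => ∑ m, capacity (ε ω m) | info Y n 0]) ω =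
      (μ[fun ω => ∑ m, capacity (ε ω m) | info Y n 0]) ω := by
  have h' := H'.condExp_sum_capacity_mul hp n ω
  rw [lik_eq_of_samePast hq, ← H.condExp_sum_capacity_mul hp n ω] at h'
  exact mul_right_cancel₀ hω.ne' h'

/-- The loss is computed under `μ'` but the bound is `μ`-a.e.: with a common past, atoms charged by
`μ` have the same mass under `μ'`, so the comparison is made atom by atom. -/
theorem cycleLoss_ae_le {q' : SeqPolicy d M} {μ' : Measure Ω}
    (H : HasLikelihood p₀ X ε Y q μ) (H' : HasLikelihood p₀ X ε Y q' μ') (hp : IsPrior p₀)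
    {n : ℕ} (hq : SeqPolicy.SamePast n q q') :
    cycleLoss X ε Y μ' n ≤ᵐ[μ] μ[fun ω => ∑ m, capacity (ε ω m) | info Y n 0] := by
  filter_upwards [H.ae_integral_lik_pos hp n] with ω hω
  rw [← H.condExp_sum_capacity_eq H' hp hq hω]
  rw [← lik_eq_of_samePast hq] at hω
  exact H'.cycleLoss_le hp n hω

/-- Along policies asking finer and finer dyadic questions in cycle `n`, the expected entropy loss
tends to the conditional expectation of the total capacity. -/
theorem ae_tendsto_cycleLoss (H : HasLikelihood p₀ X ε Y q μ) (hp : IsPrior p₀) {n : ℕ}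
    (i : Fin d) {q' : ℕ → SeqPolicy d M} {μ' : ℕ → Measure Ω}
    (H' : ∀ k, HasLikelihood p₀ X ε Y (q' k) (μ' k))
    (hq : ∀ k, SeqPolicy.SamePast n q (q' k))
    (hdy : ∀ k m h, (q' k).query n m h = evenDyadic i (k + m)) :
    ∀ᵐ ω ∂μ, Tendsto (fun k => cycleLoss X ε Y (μ' k) n ω) atTop
      (𝓝 ((μ[fun ω => ∑ m, capacity (ε ω m) | info Y n 0]) ω)) := by
  filter_upwards [H.ae_integral_lik_pos hp n] with ω hω
  set Z := ∫ θ, p₀ θ * lik q n (resp Y ω) θ with hZ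
  have hw := hp.isWeight.mul_lik q n (resp Y ω)
  have hlim : ∀ y : Fin M → Bool, Tendsto (fun k => ∫ θ, p₀ θ *
      lik (q' k) (n + 1) (Function.update (resp Y ω) n y) θ) atTop (𝓝 ((1 / 2) ^ M * Z)) := by
    intro y
    refine (tendsto_integral_mul_prod_bsc_evenDyadic i hw.integrable hw.support y).congr fun k => ?_
    simp only [lik_update, lik_eq_of_samePast (hq k), cycleLik, hdy, Function.update_self,
      mul_assoc]
  -- Only the answer entropy depends on `k`; it tends to `M * Z`.
  have h1 := ((tendsto_mul_logb_sub_sum (ι := Fin M → Bool) (M := M) (by simp) hω hlim).sub_const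
    (∫ θ, p₀ θ * lik q n (resp Y ω) θ * ∑ m, binEntropyBits (θ.2 m))).div_const Z
  rw [← H.condExp_sum_capacity_mul hp, ← hZ, mul_div_cancel_right₀ _ hω.ne'] at h1
  refine h1.congr fun k => ?_
  have h2 := (H' k).cycleLoss_mul hp n ω
  rw [lik_eq_of_samePast (hq k), ← hZ] at h2
  rw [← h2, mul_div_cancel_right₀ _ hω.ne']

end HasLikelihood

/-! ### Attaining the bound -/

section

variable {d M : ℕ}

/-- The joint policy that follows `π` before cycle `n` and asks dyadic questions from then on. -/
def JointPolicy.thenDyadic (π : JointPolicy d M) (n : ℕ) (i : Fin d) (k : ℕ) :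
    JointPolicy d M where
  query l m y := if l < n then π.query l m y else evenDyadic i (k + m)
  measurableSet_query l m y := by
    split_ifs
    · exact π.measurableSet_query l m y
    · exact measurableSet_evenDyadic i _
  adapted l m y y' h := by rw [π.adapted l m y y' h]

/-- The sequential policy that follows `q` before cycle `n` and asks dyadic questions from
then on. -/
def SeqPolicy.thenDyadic (q : SeqPolicy d M) (n : ℕ) (i : Fin d) (k : ℕ) : SeqPolicy d M where
  query l m y := if l < n then q.query l m y else evenDyadic i (k + m)
  measurableSet_query l m y := by
    split_ifs
    · exact q.measurableSet_query l m y
    · exact measurableSet_evenDyadic i _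
  adapted l m y y' h := by rw [q.adapted l m y y' h]

theorem JointPolicy.samePast_thenDyadic (π : JointPolicy d M) (n : ℕ) (i : Fin d) (k : ℕ) :
    JointPolicy.SamePast n π (π.thenDyadic n i k) := by
  intro l hl
  simp [thenDyadic, hl]

theorem SeqPolicy.samePast_thenDyadic (q : SeqPolicy d M) (n : ℕ) (i : Fin d) (k : ℕ) :
    SeqPolicy.SamePast n q (q.thenDyadic n i k) := by
  intro l hl
  simp [thenDyadic, hl]

variable {Ω : Type*} [MeasurableSpace Ω]

/-- The family of policies may be uncountable, but testing a competing bound along one sequence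
involves only countably many null sets. -/
theorem isEssSup_of_ae_tendsto {μ : Measure Ω} {S : Set (Ω → ℝ)} {g : Ω → ℝ}
    (hle : ∀ f ∈ S, f ≤ᵐ[μ] g) {u : ℕ → Ω → ℝ} (hu : ∀ k, u k ∈ S)
    (hlim : ∀ᵐ ω ∂μ, Tendsto (fun k => u k ω) atTop (𝓝 (g ω))) : IsEssSup μ S g := by
  refine ⟨hle, fun g' hg' => ?_⟩
  filter_upwards [hlim, ae_all_iff.2 fun k => hg' _ (hu k)] with ω h1 h2
  exact le_of_tendsto' h1 h2

theorem IsEssSup.ae_eq {μ : Measure Ω} {S : Set (Ω → ℝ)} {g g' : Ω → ℝ} (hg : IsEssSup μ S g)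
    (hg' : IsEssSup μ S g') : g =ᵐ[μ] g' :=
  (hg.2 g' hg'.1).antisymm (hg'.2 g hg.1)

theorem HasLikelihood.integral_condExp_sum_capacity {p₀ : Param d M → ℝ} {X : Ω → Target d}
    {ε : Ω → Fin M → ℝ} {Y : ℕ → Fin M → Ω → Bool} {q : SeqPolicy d M} {μ : Measure Ω}
    (H : HasLikelihood p₀ X ε Y q μ) (hp : IsPrior p₀) (n : ℕ) :
    ∫ ω, (μ[fun ω => ∑ m, capacity (ε ω m) | info Y n 0]) ω ∂μ =
      ∫ θ, (∑ m, capacity (θ.2 m)) * p₀ θ := by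
  have := H.isProbabilityMeasure
  rw [integral_condExp (info_le H.measurable_response n 0)]
  simp_rw [mul_comm _ (p₀ _)]
  exact H.integral_comp hp measurable_sum_capacity

theorem isMaxSeqLoss_condExp_sum_capacity (hd : 0 < d) {p₀ : Param d M → ℝ} (hp : IsPrior p₀)
    {X : Ω → Target d} {ε : Ω → Fin M → ℝ} {Y : ℕ → Fin M → Ω → Bool}
    {Q : SeqPolicy d M → Measure Ω} (hQ : ∀ σ, IsSeqScheme p₀ X ε Y σ (Q σ)) (n : ℕ)
    (σ : SeqPolicy d M) :
    IsMaxSeqLoss X ε Y Q σ n ((Q σ)[fun ω => ∑ m, capacity (ε ω m) | info Y n 0]) := by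
  have H := fun σ => (hQ σ).hasLikelihood hp
  -- Dyadic questions about a single coordinate suffice; `0 < d` provides one.
  refine isEssSup_of_ae_tendsto (u := fun k =>
    cycleLoss X ε Y (Q (σ.thenDyadic n ⟨0, hd⟩ k)) n) ?_
    (fun k => ⟨_, σ.samePast_thenDyadic n ⟨0, hd⟩ k, rfl⟩)
    ((H σ).ae_tendsto_cycleLoss hp ⟨0, hd⟩ (fun k => H (σ.thenDyadic n ⟨0, hd⟩ k))
      (σ.samePast_thenDyadic n ⟨0, hd⟩) fun k m h => by simp [SeqPolicy.thenDyadic])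
  rintro _ ⟨σ', hσ, rfl⟩
  exact (H σ).cycleLoss_ae_le (H σ') hp hσ

theorem isMaxJointLoss_condExp_sum_capacity (hd : 0 < d) {p₀ : Param d M → ℝ}
    (hp : IsPrior p₀) {X : Ω → Target d} {ε : Ω → Fin M → ℝ} {Y : ℕ → Fin M → Ω → Bool}
    {P : JointPolicy d M → Measure Ω} (hP : ∀ π, IsJointScheme p₀ X ε Y π (P π)) (n : ℕ)
    (π : JointPolicy d M) :
    IsMaxJointLoss X ε Y P π n ((P π)[fun ω => ∑ m, capacity (ε ω m) | info Y n 0]) := by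
  have H := fun π => (hP π).hasLikelihood hp
  refine isEssSup_of_ae_tendsto (u := fun k =>
    cycleLoss X ε Y (P (π.thenDyadic n ⟨0, hd⟩ k)) n) ?_
    (fun k => ⟨_, π.samePast_thenDyadic n ⟨0, hd⟩ k, rfl⟩)
    ((H π).ae_tendsto_cycleLoss hp ⟨0, hd⟩ (fun k => H (π.thenDyadic n ⟨0, hd⟩ k))
      (π.samePast_thenDyadic n ⟨0, hd⟩) fun k m h => by
        simp [JointPolicy.thenDyadic, JointPolicy.toSeq])
  rintro _ ⟨π', hπ, rfl⟩
  exact (H π).cycleLoss_ae_le (H π') hp hπ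

end

end TwentyQuestions
end

open TwentyQuestions in
theorem theorem7 {d M : ℕ} (hd : 0 < d) (p₀ : Param d M → ℝ) (hp₀ : IsPrior p₀)
    {Ω : Type*} [MeasurableSpace Ω] (X : Ω → Target d) (ε : Ω → Fin M → ℝ)
    (Y : ℕ → Fin M → Ω → Bool) (P : JointPolicy d M → Measure Ω)
    (hP : ∀ π, IsJointScheme p₀ X ε Y π (P π))
    {Ω' : Type*} [MeasurableSpace Ω'] (X' : Ω' → Target d) (ε' : Ω' → Fin M → ℝ)
    (Y' : ℕ → Fin M → Ω' → Bool) (Q : SeqPolicy d M → Measure Ω')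
    (hQ : ∀ σ, IsSeqScheme p₀ X' ε' Y' σ (Q σ)) (n : ℕ) :
    (∀ σ, IsMaxSeqLoss X' ε' Y' Q σ n
      ((Q σ)[fun ω => ∑ m, capacity (ε' ω m) | info Y' n 0])) ∧
    (∀ π, IsMaxJointLoss X ε Y P π n
      ((P π)[fun ω => ∑ m, capacity (ε ω m) | info Y n 0])) ∧
    (∀ σ π (Gseq : Ω' → ℝ) (G : Ω → ℝ), IsMaxSeqLoss X' ε' Y' Q σ n Gseq →
      IsMaxJointLoss X ε Y P π n G →
      ∫ ω, Gseq ω ∂(Q σ) = ∫ θ, (∑ m, capacity (θ.2 m)) * p₀ θ ∧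
      ∫ ω, G ω ∂(P π) = ∫ θ, (∑ m, capacity (θ.2 m)) * p₀ θ) := by
  have hseq := isMaxSeqLoss_condExp_sum_capacity hd hp₀ hQ n
  have hjoint := isMaxJointLoss_condExp_sum_capacity hd hp₀ hP n
  refine ⟨hseq, hjoint, fun σ π Gseq G hGseq hG => ⟨?_, ?_⟩⟩
  -- Essential suprema are a.e. unique, so the arbitrary version can be replaced by the conditional
  -- expectation.
  · rw [integral_congr_ae (IsEssSup.ae_eq hGseq (hseq σ))]
    exact ((hQ σ).hasLikelihood hp₀).integral_condExp_sum_capacity hp₀ n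
  · rw [integral_congr_ae (IsEssSup.ae_eq hG (hjoint π))]
    exact ((hP π).hasLikelihood hp₀).integral_condExp_sum_capacity hp₀ n
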